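/- Let $F\ge 1$. Units $0,1,2,\dots$ have fixed factor loadings $\mu_0,\mu_1,\mu_2,\dots\in\mathbb R^F$ (column vectors); unit $0$ is treated after time $0$ and the units $1,2,\dots$ are never treated. Potential outcomes are $y^N_{it}=\lambda_t\mu_i+\epsilon_{it}$ without treatment and $y^I_{it}=\alpha_{it}+y^N_{it}$ with treatment, where $\lambda_t$ is a random $1\times F$ vector of common factors; one observes $y_{0t}=y^I_{0t}$ for $t>0$ and $y_{it}=y^N_{it}$ otherwise. There are $T_0$ pre-treatment periods $\mathcal T_0=\{-T_0+1,\dots,0\}$ and $J=J(T_0)$ control units $1,\dots,J$. Put $\mathbf y_t=(y_{1t},\dots,y_{Jt})'$, let $\mathbf M_J$ be the $J\times F$ matrix with rows $\mu_1',\dots,\mu_J'$, let $$\widehat{\mathbf b}_{\rm OLS}\in\operatorname*{argmin}_{\mathbf b\in\mathbb R^J}\ \frac1{T_0}\sum_{t\in\mathcal T_0}\left(y_{0t}-\mathbf b'\mathbf y_t\right)^2,\qquad \widehat\mu_{\rm OLS}=\mathbf M_J'\,\widehat{\mathbf b}_{\rm OLS},$$ and let $\mathbf Y=(\mathbf y_t)_{t\in\mathcal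 T_0}$. Assume: (i) $T_0\ge J(T_0)$ for every $T_0$, and $J(T_0)\to\infty$ as $T_0\to\infty$; (ii) for some constants $\underline a,\bar a>0$, let $R=R_J$ be the largest number of pairwise disjoint groups of $F$ of the control units $1,\dots,J$ such that the $F\times F$ matrix of factor loadings of each group has its smallest singular value greater than $\underline a$ and its largest singular value smaller than $\bar a$; then $R_J\to\infty$ as $J\to\infty$; (iii) $\epsilon_{it}\sim N(0,\sigma_i^2)$ for all $i,t$, where $\sigma_j^2>0$ for every control unit $j\geq 1$ and $\sup_i\sigma_i^2<\infty$; $\lambda_t\sim N(0,\boldsymbol\Omega)$ for all $t$, with $\boldsymbol\Omega$ positive definite; and all the variables $\epsilon_{it}$ and vectors $\lambda_t$ are mutually independent. Then the bias of $\widehat\mu_{\rm OLS}$ tends to zero as $T_0\to\infty$, whatever the behaviour of $J/T_0$ (in particular even when $J/T_0\to1$). Precisely, $\widehat\mu_{\rm OLS}-\mu_0$ is integrable whenever $J(T_0)<T_0$, and there are non-random vectors $\beta_{T_0}\in\mathbb R^F$ with $\beta_{T_0}\to 0$ such that $\mathbb E[\widehat\mu_{\rm OLS}-\mu_0]=\beta_{T_0}$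 for every $T_0$ for which $\widehat\mu_{\rm OLS}-\mu_0$ is integrable; moreover, for every $T_0$ (including $J(T_0)=T_0$, where $\widehat\mu_{\rm OLS}$ need not be integrable) the conditional distribution of $\widehat\mu_{\rm OLS}-\mu_0$ given $\mathbf Y$ almost surely has a finite mean, and $\mathbb E[\widehat\mu_{\rm OLS}-\mu_0\mid\mathbf Y]=\beta_{T_0}$ almost surely. -/

import Mathlib

open MeasureTheory ProbabilityTheory Filter Topology
open scoped NNReal Matrix

noncomputable section

namespace SynthControl

/-! ### The linear factor model -/

/-- Potential outcome of unit `i` at time `t` without treatment: `λ_t μ_i + ε_{it}`.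
Unit `0` is the treated unit, units `1, 2, …` are the controls. -/
def outcomeN {Ω : Type*} {F : ℕ} (lam : ℤ → Ω → EuclideanSpace ℝ (Fin F)) (mu : ℕ → Fin F → ℝ)
    (eps : ℕ → ℤ → Ω → ℝ) (i : ℕ) (t : ℤ) (ω : Ω) : ℝ :=
  (∑ f, lam t ω f * mu i f) + eps i t ω

/-- Potential outcome of unit `i` at time `t` with treatment. -/
def outcomeI {Ω : Type*} {F : ℕ} (lam : ℤ → Ω → EuclideanSpace ℝ (Fin F)) (mu : ℕ → Fin F → ℝ)
    (eps : ℕ → ℤ → Ω → ℝ) (alpha : ℕ → ℤ → Ω → ℝ) (i : ℕ) (t : ℤ) (ω : Ω) : ℝ :=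
  alpha i t ω + outcomeN lam mu eps i t ω

/-- Treatment indicator: only unit `0` is treated, and only after time `0`. -/
def treated (i : ℕ) (t : ℤ) : ℝ := if i = 0 ∧ 0 < t then 1 else 0

/-- The observed outcome `y_{it}`. -/
def outcome {Ω : Type*} {F : ℕ} (lam : ℤ → Ω → EuclideanSpace ℝ (Fin F)) (mu : ℕ → Fin F → ℝ)
    (eps : ℕ → ℤ → Ω → ℝ) (alpha : ℕ → ℤ → Ω → ℝ) (i : ℕ) (t : ℤ) (ω : Ω) : ℝ :=
  treated i t * outcomeI lam mu eps alpha i t ω + (1 - treated i t) * outcomeN lam mu eps i t ω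

/-- The pre-treatment periods `-T₀ + 1, …, -1, 0`. -/
def preTimes (T₀ : ℕ) : Finset ℤ := Finset.Icc (-(T₀ : ℤ) + 1) 0

/-- The `J × F` matrix of factor loadings of the controls; row `j : Fin J` belongs to
unit `j + 1`. -/
def loadingMatrix {F : ℕ} (mu : ℕ → Fin F → ℝ) (J : ℕ) : Matrix (Fin J) (Fin F) ℝ :=
  Matrix.of fun j f => mu ((j : ℕ) + 1) f

/-! ### The OLS weights and the implied loadings -/

/-- The least squares objective `(1 / T₀) ∑_t (y_{0t} - b' y_t)²` over the pre-treatment periods,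
for an array of outcomes `y i t`. -/
def olsObjective (y : ℕ → ℤ → ℝ) (T₀ J : ℕ) (b : Fin J → ℝ) : ℝ :=
  (1 / (T₀ : ℝ)) * ∑ t ∈ preTimes T₀, (y 0 t - ∑ j : Fin J, b j * y ((j : ℕ) + 1) t) ^ 2

/-- `b` is a vector of OLS weights: it minimizes the least squares objective over `ℝ^J`. -/
def IsOLS (y : ℕ → ℤ → ℝ) (T₀ J : ℕ) (b : Fin J → ℝ) : Prop :=
  ∀ b' : Fin J → ℝ, olsObjective y T₀ J b ≤ olsObjective y T₀ J b'

/-- The factor loadings `M_J' b` implied by weights `b`. -/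
def impliedLoadings {F J : ℕ} (mu : ℕ → Fin F → ℝ) (b : Fin J → ℝ) : Fin F → ℝ :=
  (loadingMatrix mu J)ᵀ *ᵥ b

/-- The pre-treatment outcomes of the first `J` controls. -/
def controlOutcomes {Ω : Type*} (y : ℕ → ℤ → Ω → ℝ) (T₀ J : ℕ) (ω : Ω) :
    preTimes T₀ → Fin J → ℝ :=
  fun t j => y ((j : ℕ) + 1) t ω

/-! ### The assumption on the loadings -/

/-- All singular values of the square matrix `A` lie strictly between `a` and `b`. -/
def SingularValuesBetween {F : ℕ} (a b : ℝ) (A : Matrix (Fin F) (Fin F) ℝ) : Prop :=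
  ∀ f : Fin F, a < (Matrix.toEuclideanLin A).singularValues f ∧
    (Matrix.toEuclideanLin A).singularValues f < b

/-- `g` lists `r` pairwise disjoint groups of `F` distinct units among the first `J` controls such
that the `F × F` loading matrix of every group has its singular values strictly between
`a` and `b`. -/
def IsGroupFamily {F : ℕ} (mu : ℕ → Fin F → ℝ) (a b : ℝ) (J r : ℕ)
    (g : Fin r → Fin F → Fin J) : Prop :=
  (Function.Injective fun q : Fin r × Fin F => g q.1 q.2) ∧
    ∀ p : Fin r, SingularValuesBetween a b ((loadingMatrix mu J).submatrix (g p) id)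

/-- The largest number of groups as above (the set is bounded by `J` if `1 ≤ F`). -/
def numGroups {F : ℕ} (mu : ℕ → Fin F → ℝ) (a b : ℝ) (J : ℕ) : ℕ :=
  sSup {r : ℕ | ∃ g : Fin r → Fin F → Fin J, IsGroupFamily mu a b J r g}

/-! ### The assumption on shocks and factors -/

/-- The shocks `ε_{it}` are `N(0, σ_i²)`, the factors `λ_t` are `N(0, S)`, and all the variables
`ε_{it}` and (vectors) `λ_t` are mutually independent. -/
structure GaussianModel {Ω : Type*} [MeasurableSpace Ω] (P : Measure Ω) {F : ℕ}
    (eps : ℕ → ℤ → Ω → ℝ) (lam : ℤ → Ω → EuclideanSpace ℝ (Fin F)) (σ : ℕ → ℝ≥0)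
    (S : Matrix (Fin F) (Fin F) ℝ) : Prop where
  eps_law : ∀ i t, HasLaw (eps i t) (gaussianReal 0 (σ i ^ 2)) P
  lam_law : ∀ t, HasLaw (lam t) (multivariateGaussian 0 S) P
  eps_indep : iIndepFun (fun q : ℕ × ℤ => eps q.1 q.2) P
  lam_indep : iIndepFun lam P
  eps_lam_indep : IndepFun (fun ω (q : ℕ × ℤ) => eps q.1 q.2 ω) (fun ω (t : ℤ) => lam t ω) P

/-! ### Conditional means -/

/-- `E[Z | X] = v` almost surely, for the non-random vector `v`, in the sense that the regular
conditional distribution of `Z` given `X` almost surely has a finite first moment and mean `v`.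
This does not require `Z` to be integrable; if `Z` is, then it implies `E[Z] = v`. -/
def HasConstCondMean {Ω 𝓧 : Type*} [MeasurableSpace Ω] [MeasurableSpace 𝓧] (P : Measure Ω)
    [IsFiniteMeasure P] {F : ℕ} (Z : Ω → Fin F → ℝ) (X : Ω → 𝓧) (v : Fin F → ℝ) : Prop :=
  ∀ᵐ ω ∂P, Integrable (fun z : Fin F → ℝ => z) (condDistrib Z X P (X ω)) ∧
    ∫ z, z ∂(condDistrib Z X P (X ω)) = v

end SynthControl

end

/-! Write the treated unit's outcome as its population regression on the controls: `y_0t = g'y_t +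
u_t`. Outcomes are jointly Gaussian and the normal equations make `u` uncorrelated with all control
outcomes, so `u` is centred and independent of `Y` (`indepFun_controlRows_regressionResidual`).
Almost surely the control outcomes have full rank, and then the OLS weights are exactly `g` plus the
least squares coefficients of `u` on the controls, which are linear in `u` for fixed `Y`. Averaging
over `u` leaves `β = M'g - μ₀` as the conditional mean. It depends on `T₀` only through the number
of controls, so the ratio `J/T₀` plays no role.

Why `β → 0`: with `D` the diagonal matrix of shock variances, the normal equations read `D g = -M S
β`. Pairing with `g` gives `β'Sβ + |D^(-1/2) M S β|² = -μ₀'Sβ` (`energy_identity`). Each disjoint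
group contributes at least `a²|w|²` to `|M w|²`, so with `w = Sβ`, `R` groups and variances at most
`K`, one gets `(R a²/K)|w|² ≤ |μ₀||w|`. Hence `Sβ → 0`, and `S` is invertible.

Integrability when `J < T₀`: a least squares coefficient times the component of its row along any
unit vector orthogonal to the other rows is at most the norm of the regressand. One direction would
give a bound by `1/|x|` with `x` Gaussian, which is not integrable. The other `J - 1` rows leave
room for two orthonormal directions, and the geometric mean of the two bounds is
`|x|^(-1/2)|y|^(-1/2)` with `x`, `y` independent Gaussians, which is integrable
(`exists_lintegral_leastSquares_le`). Common factors make the rows dependent, so this is done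
conditionally on the factors, with bounds uniform in the mean. -/

namespace SynthControl

/-! ### Least squares -/

/-- The coefficients of the least squares regression of `w` on the rows of `C`. -/
noncomputable def leastSquares {m n : Type*} [Fintype m] [DecidableEq m] [Fintype n]
    (C : Matrix m n ℝ) (w : n → ℝ) : m → ℝ :=
  (C * Cᵀ)⁻¹ *ᵥ (C *ᵥ w)

section LeastSquares

variable {m n : Type*} [Fintype m] [DecidableEq m] [Fintype n] {C : Matrix m n ℝ}

lemma isUnit_det_of_linearIndependent (hC : LinearIndependent ℝ C.row) :
    IsUnit (C * Cᵀ).det := by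
  have h := Matrix.PosDef.mul_conjTranspose_self C (Matrix.vecMul_injective_iff.2 hC)
  rw [Matrix.conjTranspose_eq_transpose_of_trivial] at h
  exact h.det_pos.ne'.isUnit

lemma leastSquares_add (C : Matrix m n ℝ) (v w : n → ℝ) :
    leastSquares C (v + w) = leastSquares C v + leastSquares C w := by
  simp [leastSquares, Matrix.mulVec_add]

lemma leastSquares_transpose_mulVec (hC : IsUnit (C * Cᵀ).det) (g : m → ℝ) :
    leastSquares C (Cᵀ *ᵥ g) = g := by
  rw [leastSquares, Matrix.mulVec_mulVec, Matrix.mulVec_mulVec, Matrix.mul_assoc,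
    Matrix.nonsing_inv_mul _ hC, Matrix.one_mulVec]

lemma mulVec_residual (hC : IsUnit (C * Cᵀ).det) (w : n → ℝ) :
    C *ᵥ (w - Cᵀ *ᵥ leastSquares C w) = 0 := by
  rw [Matrix.mulVec_sub, leastSquares, Matrix.mulVec_mulVec, Matrix.mulVec_mulVec,
    Matrix.mul_nonsing_inv _ hC, Matrix.one_mulVec, sub_self]

/-- Pythagoras' identity for least squares. -/
lemma dotProduct_residual (hC : IsUnit (C * Cᵀ).det) (w : n → ℝ) (b : m → ℝ) :
    (w - Cᵀ *ᵥ b) ⬝ᵥ (w - Cᵀ *ᵥ b) =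
      (w - Cᵀ *ᵥ leastSquares C w) ⬝ᵥ (w - Cᵀ *ᵥ leastSquares C w) +
        (Cᵀ *ᵥ (leastSquares C w - b)) ⬝ᵥ (Cᵀ *ᵥ (leastSquares C w - b)) := by
  have h : (w - Cᵀ *ᵥ leastSquares C w) ⬝ᵥ (Cᵀ *ᵥ (leastSquares C w - b)) = 0 := by
    rw [Matrix.dotProduct_mulVec, Matrix.vecMul_transpose, mulVec_residual hC, zero_dotProduct]
  have e : w - Cᵀ *ᵥ b =
      (w - Cᵀ *ᵥ leastSquares C w) + Cᵀ *ᵥ (leastSquares C w - b) := by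
    rw [Matrix.mulVec_sub]; abel
  rw [e, add_dotProduct, dotProduct_add, dotProduct_add, h,
    dotProduct_comm (Cᵀ *ᵥ (leastSquares C w - b)) (w - Cᵀ *ᵥ leastSquares C w), h]
  ring

/-- By Pythagoras the excess loss of `b` is the squared norm of `Cᵀ (leastSquares C w - b)`, and
`Cᵀ` is injective at full rank. -/
lemma eq_leastSquares_of_minimizer (hC : IsUnit (C * Cᵀ).det) {w : n → ℝ} {b : m → ℝ}
    (hb : ∀ b', (w - Cᵀ *ᵥ b) ⬝ᵥ (w - Cᵀ *ᵥ b) ≤ (w - Cᵀ *ᵥ b') ⬝ᵥ (w - Cᵀ *ᵥ b')) :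
    b = leastSquares C w := by
  have h := hb (leastSquares C w)
  rw [dotProduct_residual hC w b] at h
  have h0 : Cᵀ *ᵥ (leastSquares C w - b) = 0 := by
    have h1 : (Cᵀ *ᵥ (leastSquares C w - b)) ⬝ᵥ (Cᵀ *ᵥ (leastSquares C w - b)) ≤ 0 := by
      linarith
    exact dotProduct_self_eq_zero.1
      (le_antisymm h1 (Finset.sum_nonneg fun i _ => mul_self_nonneg _))
  have h2 : leastSquares C w - b = 0 := by
    rw [← leastSquares_transpose_mulVec hC (leastSquares C w - b), h0]
    simp [leastSquares]
  exact (sub_eq_zero.1 h2).symm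

lemma dotProduct_fitted_le (hC : IsUnit (C * Cᵀ).det) (w : n → ℝ) :
    (Cᵀ *ᵥ leastSquares C w) ⬝ᵥ (Cᵀ *ᵥ leastSquares C w) ≤ w ⬝ᵥ w := by
  have h := dotProduct_residual hC w 0
  simp only [Matrix.mulVec_zero, sub_zero] at h
  rw [h]
  have : 0 ≤ (w - Cᵀ *ᵥ leastSquares C w) ⬝ᵥ (w - Cᵀ *ᵥ leastSquares C w) :=
    Finset.sum_nonneg fun i _ => mul_self_nonneg _
  linarith

/-- A coefficient is controlled by the component of its row along any unit vector that is
orthogonal to the other rows. -/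
lemma sq_leastSquares_mul_sq_le (C : Matrix m n ℝ) (w e : n → ℝ) (j : m)
    (he : e ⬝ᵥ e = 1) (horth : ∀ i, i ≠ j → C i ⬝ᵥ e = 0) :
    leastSquares C w j ^ 2 * (C j ⬝ᵥ e) ^ 2 ≤ w ⬝ᵥ w := by
  have hw : 0 ≤ w ⬝ᵥ w := Finset.sum_nonneg fun i _ => mul_self_nonneg _
  by_cases hC : IsUnit (C * Cᵀ).det
  -- Only row `j` of the fitted vector is visible along `e`; Cauchy-Schwarz and the contraction
  -- property of the projection do the rest.
  · have h1 : (Cᵀ *ᵥ leastSquares C w) ⬝ᵥ e = leastSquares C w j * (C j ⬝ᵥ e) := by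
      rw [Matrix.mulVec_transpose, ← Matrix.dotProduct_mulVec, dotProduct]
      refine Finset.sum_eq_single j (fun i _ hi => ?_) (by simp)
      simp [Matrix.mulVec, horth i hi]
    have h2 : ((Cᵀ *ᵥ leastSquares C w) ⬝ᵥ e) ^ 2 ≤
        (Cᵀ *ᵥ leastSquares C w) ⬝ᵥ (Cᵀ *ᵥ leastSquares C w) * (e ⬝ᵥ e) := by
      simpa [dotProduct, sq] using
        Finset.sum_mul_sq_le_sq_mul_sq Finset.univ (Cᵀ *ᵥ leastSquares C w) e
    rw [← mul_pow, ← h1]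
    rw [he, mul_one] at h2
    exact h2.trans (dotProduct_fitted_le hC w)
  -- In the singular case the matrix inverse is `0` by convention, so the coefficients vanish.
  · simp [leastSquares, Matrix.nonsing_inv_apply_not_isUnit _ hC, hw]

end LeastSquares

/-! ### The bias -/

/-- The population regression coefficients of the treated unit on the controls. -/
noncomputable def populationWeights {m n : Type*} [Fintype m] [DecidableEq m] [Fintype n]
    (M : Matrix m n ℝ) (S : Matrix n n ℝ) (d : m → ℝ) (μ₀ : n → ℝ) : m → ℝ :=
  (M * S * Mᵀ + Matrix.diagonal d)⁻¹ *ᵥ (M *ᵥ (S *ᵥ μ₀))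

/-- The bias of the loadings implied by the population regression. -/
noncomputable def populationBias {m n : Type*} [Fintype m] [DecidableEq m] [Fintype n]
    (M : Matrix m n ℝ) (S : Matrix n n ℝ) (d : m → ℝ) (μ₀ : n → ℝ) : n → ℝ :=
  Mᵀ *ᵥ populationWeights M S d μ₀ - μ₀

section Bias

variable {m n : Type*} [Fintype m] [DecidableEq m] [Fintype n]
  {M : Matrix m n ℝ} {S : Matrix n n ℝ} {d : m → ℝ} {μ₀ : n → ℝ}

lemma mulVec_populationWeights (hS : S.PosDef) (hd : ∀ j, 0 < d j) :
    (M * S * Mᵀ + Matrix.diagonal d) *ᵥ populationWeights M S d μ₀ = M *ᵥ (S *ᵥ μ₀) := by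
  have h1 : (M * S * Mᵀ).PosSemidef := by
    simpa [Matrix.conjTranspose_eq_transpose_of_trivial] using
      hS.posSemidef.mul_mul_conjTranspose_same M
  have h2 : (M * S * Mᵀ + Matrix.diagonal d).PosDef := by
    simpa [add_comm] using (Matrix.PosDef.diagonal hd).add_posSemidef h1
  rw [populationWeights, Matrix.mulVec_mulVec, Matrix.mul_nonsing_inv _ h2.det_pos.ne'.isUnit,
    Matrix.one_mulVec]

/-- The normal equations with the term `M S Mᵀ g` moved to the right, where it combines with `M S
μ₀` into the bias. -/
lemma mul_populationWeights (hS : S.PosDef) (hd : ∀ j, 0 < d j) (j : m) :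
    d j * populationWeights M S d μ₀ j = -(M *ᵥ (S *ᵥ populationBias M S d μ₀)) j := by
  have h := congrFun (mulVec_populationWeights (M := M) (μ₀ := μ₀) hS hd) j
  rw [Matrix.add_mulVec, Pi.add_apply, Matrix.mulVec_diagonal] at h
  rw [populationBias, Matrix.mulVec_sub, Matrix.mulVec_sub, Pi.sub_apply,
    Matrix.mulVec_mulVec (v := populationWeights M S d μ₀), Matrix.mulVec_mulVec,
    ← Matrix.mul_assoc]
  linarith

/-- Comes from pairing `D g = -M S β` with `g` and substituting `Mᵀ g = β + μ₀`. -/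
lemma energy_identity (hS : S.PosDef) (hd : ∀ j, 0 < d j) :
    populationBias M S d μ₀ ⬝ᵥ (S *ᵥ populationBias M S d μ₀) +
      ∑ j, (M *ᵥ (S *ᵥ populationBias M S d μ₀)) j ^ 2 / d j =
      -(μ₀ ⬝ᵥ (S *ᵥ populationBias M S d μ₀)) := by
  set w := S *ᵥ populationBias M S d μ₀ with hw
  have h1 : populationBias M S d μ₀ ⬝ᵥ w =
      populationWeights M S d μ₀ ⬝ᵥ (M *ᵥ w) - μ₀ ⬝ᵥ w := by
    rw [Matrix.dotProduct_mulVec _ M, ← Matrix.mulVec_transpose, ← sub_dotProduct]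
    rfl
  have h2 : populationWeights M S d μ₀ ⬝ᵥ (M *ᵥ w) = -∑ j, (M *ᵥ w) j ^ 2 / d j := by
    rw [dotProduct, ← Finset.sum_neg_distrib]
    refine Finset.sum_congr rfl fun j _ => ?_
    have h3 := mul_populationWeights (M := M) (μ₀ := μ₀) hS hd j
    rw [← hw] at h3
    have h4 := (hd j).ne'
    field_simp
    linear_combination (M *ᵥ w) j * h3
  rw [h1, h2]
  ring

/-- Drop the nonnegative term `β'Sβ` from the energy identity and bound the right-hand side by
Cauchy-Schwarz: `c|w|² ≤ |μ₀||w|` for `w = Sβ`. -/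
lemma dotProduct_mulVec_populationBias_le (hS : S.PosDef) (hd : ∀ j, 0 < d j) {c : ℝ} (hc : 0 < c)
    (hM : ∀ w, c * (w ⬝ᵥ w) ≤ ∑ j, (M *ᵥ w) j ^ 2 / d j) :
    (S *ᵥ populationBias M S d μ₀) ⬝ᵥ (S *ᵥ populationBias M S d μ₀) ≤ (μ₀ ⬝ᵥ μ₀) / c ^ 2 := by
  have h := energy_identity (M := M) (μ₀ := μ₀) hS hd
  have h0 : 0 ≤ populationBias M S d μ₀ ⬝ᵥ (S *ᵥ populationBias M S d μ₀) := by
    simpa using hS.posSemidef.dotProduct_mulVec_nonneg (populationBias M S d μ₀)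
  set w := S *ᵥ populationBias M S d μ₀
  have h1 := hM w
  have hcs : (μ₀ ⬝ᵥ w) ^ 2 ≤ (μ₀ ⬝ᵥ μ₀) * (w ⬝ᵥ w) := by
    simpa [dotProduct, sq] using Finset.sum_mul_sq_le_sq_mul_sq Finset.univ μ₀ w
  have hw : 0 ≤ w ⬝ᵥ w := Finset.sum_nonneg fun i _ => mul_self_nonneg _
  have hμ : 0 ≤ μ₀ ⬝ᵥ μ₀ := Finset.sum_nonneg fun i _ => mul_self_nonneg _
  rw [le_div_iff₀ (by positivity)]
  rcases hw.eq_or_lt with h2 | h2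
  · rw [← h2]; simpa using hμ
  · have h3 : (c * (w ⬝ᵥ w)) ^ 2 ≤ (μ₀ ⬝ᵥ w) ^ 2 := by
      rw [← neg_sq (μ₀ ⬝ᵥ w)]
      exact pow_le_pow_left₀ (by positivity) (by linarith) 2
    have h4 : (w ⬝ᵥ w) * ((w ⬝ᵥ w) * c ^ 2) ≤ (w ⬝ᵥ w) * (μ₀ ⬝ᵥ μ₀) := by nlinarith
    exact le_of_mul_le_mul_left h4 h2

end Bias

/-! ### Disjoint well-conditioned groups force the bias to vanish -/

section Groups

variable {F : ℕ} {mu : ℕ → Fin F → ℝ} {a b : ℝ}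

/-- Expand `w` in an eigenbasis of `AᵀA`, whose eigenvalues are the squared singular values. -/
lemma SingularValuesBetween.le_dotProduct_mulVec {A : Matrix (Fin F) (Fin F) ℝ} (ha : 0 < a)
    (hA : SingularValuesBetween a b A) (w : Fin F → ℝ) :
    a ^ 2 * (w ⬝ᵥ w) ≤ (A *ᵥ w) ⬝ᵥ (A *ᵥ w) := by
  set T := Matrix.toEuclideanLin A with hT
  have hn : Module.finrank ℝ (EuclideanSpace ℝ (Fin F)) = F := by simp
  set x : EuclideanSpace ℝ (Fin F) := WithLp.toLp 2 w with hx
  have hsym := T.isSymmetric_adjoint_comp_self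
  have h1 : (A *ᵥ w) ⬝ᵥ (A *ᵥ w) = inner ℝ ((T.adjoint ∘ₗ T) x) x := by
    rw [LinearMap.comp_apply, LinearMap.adjoint_inner_left]
    rw [real_inner_self_eq_norm_sq, EuclideanSpace.real_norm_sq_eq]
    simp [hT, hx, dotProduct, sq]
  have h2 : w ⬝ᵥ w = ‖x‖ ^ 2 := by
    rw [EuclideanSpace.real_norm_sq_eq]
    simp [dotProduct, hx, sq]
  rw [h1, h2, ← (hsym.eigenvectorBasis hn).sum_inner_mul_inner,
    ← (hsym.eigenvectorBasis hn).sum_sq_norm_inner_right x, Finset.mul_sum]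
  refine Finset.sum_le_sum fun i _ => ?_
  have h3 : inner ℝ ((T.adjoint ∘ₗ T) x) (hsym.eigenvectorBasis hn i) =
      hsym.eigenvalues hn i * inner ℝ (hsym.eigenvectorBasis hn i) x := by
    rw [hsym, hsym.apply_eigenvectorBasis, inner_smul_right, real_inner_comm]
    simp
  rw [h3, ← T.sq_singularValues_fin hn i, Real.norm_eq_abs, sq_abs, mul_assoc, ← sq]
  gcongr
  exact (hA i).1.le

lemma IsGroupFamily.card_le {J r : ℕ} {g : Fin r → Fin F → Fin J} (hg : IsGroupFamily mu a b J r g)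
    (hF : 1 ≤ F) : r ≤ J := by
  have h := Fintype.card_le_of_injective _ hg.1
  simp only [Fintype.card_prod, Fintype.card_fin] at h
  nlinarith

lemma exists_isGroupFamily_numGroups (mu : ℕ → Fin F → ℝ) (a b : ℝ) (hF : 1 ≤ F) (J : ℕ) :
    ∃ g : Fin (numGroups mu a b J) → Fin F → Fin J,
      IsGroupFamily mu a b J (numGroups mu a b J) g := by
  -- The supremum is attained: the empty family gives `r = 0`, and disjointness with `1 ≤ F` bounds
  -- `r` by `J`.
  refine Nat.sSup_mem (s := {r : ℕ | ∃ g : Fin r → Fin F → Fin J, IsGroupFamily mu a b J r g})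
    ⟨0, fun p => p.elim0, fun p => p.1.elim0, fun p => p.elim0⟩ ⟨J, ?_⟩
  rintro r ⟨g, hg⟩
  exact hg.card_le hF

/-- Each group contributes at least `a²|w|²`, and disjointness lets the contributions add up inside
the full sum. -/
lemma numGroups_mul_le (hF : 1 ≤ F) (ha : 0 < a) (J : ℕ) (w : Fin F → ℝ) :
    numGroups mu a b J * a ^ 2 * (w ⬝ᵥ w) ≤ ∑ j, (loadingMatrix mu J *ᵥ w) j ^ 2 := by
  obtain ⟨g, hg⟩ := exists_isGroupFamily_numGroups mu a b hF J
  calc numGroups mu a b J * a ^ 2 * (w ⬝ᵥ w)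
      = ∑ _p : Fin (numGroups mu a b J), a ^ 2 * (w ⬝ᵥ w) := by simp; ring
    _ ≤ ∑ p : Fin (numGroups mu a b J), ∑ f, (loadingMatrix mu J *ᵥ w) (g p f) ^ 2 := by
        refine Finset.sum_le_sum fun p _ => ((hg.2 p).le_dotProduct_mulVec ha w).trans_eq ?_
        rw [dotProduct]
        refine Finset.sum_congr rfl fun f _ => ?_
        rw [sq]; rfl
    _ = ∑ q : Fin (numGroups mu a b J) × Fin F,
          (loadingMatrix mu J *ᵥ w) (g q.1 q.2) ^ 2 := by rw [Fintype.sum_prod_type]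
    _ = ∑ j ∈ Finset.univ.map ⟨_, hg.1⟩, (loadingMatrix mu J *ᵥ w) j ^ 2 := by
        rw [Finset.sum_map]; rfl
    _ ≤ ∑ j, (loadingMatrix mu J *ᵥ w) j ^ 2 :=
        Finset.sum_le_sum_of_subset_of_nonneg (Finset.subset_univ _) fun _ _ _ => sq_nonneg _

lemma tendsto_populationBias (hF : 1 ≤ F) (ha : 0 < a)
    (hgroups : Tendsto (fun n : ℕ => numGroups mu a b n) atTop atTop)
    {S : Matrix (Fin F) (Fin F) ℝ} (hS : S.PosDef) {v : ℕ → ℝ} (hv : ∀ j, 1 ≤ j → 0 < v j)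
    {K : ℝ} (hK : ∀ j, v j ≤ K) :
    Tendsto (fun n : ℕ => populationBias (loadingMatrix mu n) S
      (fun j : Fin n => v ((j : ℕ) + 1)) (mu 0)) atTop (𝓝 0) := by
  set β := fun n : ℕ => populationBias (loadingMatrix mu n) S
    (fun j : Fin n => v ((j : ℕ) + 1)) (mu 0) with hβ
  have hK0 : 0 < K := (hv 1 le_rfl).trans_le (hK 1)
  set c : ℕ → ℝ := fun n => numGroups mu a b n * a ^ 2 / K with hc
  have hctop : Tendsto c atTop atTop := by
    have h := (tendsto_natCast_atTop_atTop (R := ℝ)).comp hgroups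
    exact (h.atTop_mul_const (by positivity : 0 < a ^ 2)).atTop_div_const hK0
  have hbound : ∀ᶠ n in atTop, (S *ᵥ β n) ⬝ᵥ (S *ᵥ β n) ≤ (mu 0 ⬝ᵥ mu 0) / c n ^ 2 := by
    filter_upwards [hctop.eventually_gt_atTop 0] with n hn
    refine dotProduct_mulVec_populationBias_le hS (fun j => hv _ (by omega)) hn fun w => ?_
    calc c n * (w ⬝ᵥ w) = (numGroups mu a b n * a ^ 2 * (w ⬝ᵥ w)) / K := by rw [hc]; ring
      _ ≤ (∑ j, (loadingMatrix mu n *ᵥ w) j ^ 2) / K := by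
          gcongr; exact numGroups_mul_le hF ha n w
      _ ≤ ∑ j : Fin n, (loadingMatrix mu n *ᵥ w) j ^ 2 / v ((j : ℕ) + 1) := by
          rw [Finset.sum_div]
          refine Finset.sum_le_sum fun j _ => ?_
          gcongr
          · exact hv _ (by omega)
          · exact hK _
  have hlim : Tendsto (fun n => (mu 0 ⬝ᵥ mu 0) / c n ^ 2) atTop (𝓝 0) :=
    tendsto_const_nhds.div_atTop ((tendsto_pow_atTop two_ne_zero).comp hctop)
  have hsq : Tendsto (fun n => (S *ᵥ β n) ⬝ᵥ (S *ᵥ β n)) atTop (𝓝 0) :=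
    tendsto_of_tendsto_of_tendsto_of_le_of_le' tendsto_const_nhds hlim
      (Eventually.of_forall fun n => Finset.sum_nonneg fun i _ => mul_self_nonneg _) hbound
  have hw : Tendsto (fun n => S *ᵥ β n) atTop (𝓝 0) := by
    refine tendsto_pi_nhds.2 fun f => ?_
    have h1 : Tendsto (fun n => (S *ᵥ β n) f ^ 2) atTop (𝓝 0) := by
      refine tendsto_of_tendsto_of_tendsto_of_le_of_le tendsto_const_nhds hsq
        (fun n => sq_nonneg _) fun n => ?_
      rw [dotProduct]
      simp only [sq]
      exact Finset.single_le_sum (f := fun i => (S *ᵥ β n) i * (S *ᵥ β n) i)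
        (fun i _ => mul_self_nonneg _) (Finset.mem_univ f)
    have h2 := h1.sqrt
    simp only [Real.sqrt_sq_eq_abs, Real.sqrt_zero] at h2
    exact (tendsto_zero_iff_abs_tendsto_zero _).2 h2
  -- The bound concerns `Sβ`; applying the fixed matrix `S⁻¹` recovers `β`.
  have hcont : Continuous fun w : Fin F → ℝ => S⁻¹ *ᵥ w := by fun_prop
  have h := (hcont.tendsto 0).comp hw
  simpa [Function.comp_def, Matrix.nonsing_inv_mul _ hS.det_pos.ne'.isUnit] using h

end Groups

/-! ### Gaussian matrices -/

/-! ### Almost sure linear independence -/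

section LinearIndependence

/-- Vectors with independent perturbations that do not charge proper affine subspaces are almost
surely linearly independent, as long as there are not too many of them. -/
lemma ae_linearIndependent_add {V : Type*} [NormedAddCommGroup V] [NormedSpace ℝ V]
    [FiniteDimensional ℝ V] [MeasurableSpace V] [BorelSpace V]
    {n : ℕ} (hn : n ≤ Module.finrank ℝ V) (ν : Fin n → Measure V) [∀ i, SigmaFinite (ν i)]
    (hν : ∀ i (x : V) (W : Submodule ℝ V), W ≠ ⊤ → ν i {y | x + y ∈ W} = 0) (N : Fin n → V) :
    ∀ᵐ E ∂Measure.pi ν, LinearIndependent ℝ (N + E) := by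
  induction n with
  | zero => exact Eventually.of_forall fun E => linearIndependent_empty_type
  | succ n ih =>
    have ih' := ih (by omega) (fun i => ν (Fin.succAbove 0 i)) (fun i => hν _)
      (fun i => N (Fin.succAbove 0 i))
    have hmp := (measurePreserving_piFinSuccAbove ν 0).quasiMeasurePreserving
    have hmeas : MeasurableSet {p : V × (Fin n → V) |
        LinearIndependent ℝ (Fin.cons (N 0 + p.1) ((fun i => N (Fin.succAbove 0 i)) + p.2) :
          Fin (n + 1) → V)} := by
      have hcont : Continuous fun p : V × (Fin n → V) =>
          (Fin.cons (N 0 + p.1) ((fun i => N (Fin.succAbove 0 i)) + p.2) : Fin (n + 1) → V) := by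
        refine continuous_pi fun i => ?_
        refine Fin.cases ?_ (fun i => ?_) i
        · simp only [Fin.cons_zero]; fun_prop
        · simp only [Fin.cons_succ]; fun_prop
      exact (isOpen_setOfPred_linearIndependent.preimage hcont).measurableSet
    have key : ∀ᵐ p ∂(ν 0).prod (Measure.pi fun i => ν (Fin.succAbove 0 i)),
        LinearIndependent ℝ (Fin.cons (N 0 + p.1) ((fun i => N (Fin.succAbove 0 i)) + p.2) :
          Fin (n + 1) → V) := by
      -- Fubini with the last `n` vectors fixed first: their span is proper, and the first vector
      -- almost surely avoids it.
      rw [Measure.ae_prod_iff_ae_ae hmeas]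
      rw [Measure.ae_ae_comm hmeas]
      filter_upwards [ih'] with E hE
      set W := Submodule.span ℝ (Set.range ((fun i => N (Fin.succAbove 0 i)) + E)) with hW
      have hWtop : W ≠ ⊤ := by
        intro h
        have h1 := finrank_span_eq_card hE
        rw [← hW, h, finrank_top, Fintype.card_fin] at h1
        omega
      have h3 : ∀ᵐ x ∂ν 0, N 0 + x ∉ W := by
        rw [ae_iff]
        simp only [not_not]
        exact hν 0 (N 0) W hWtop
      filter_upwards [h3] with x hx
      exact linearIndependent_finCons.2 ⟨hE, hx⟩
    filter_upwards [hmp.ae key] with E hE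
    convert hE using 1
    ext i
    refine Fin.cases ?_ (fun i => ?_) i
    · rfl
    · rfl

end LinearIndependence

/-! ### Integrability of the inverse square root of a Gaussian -/

section SingularIntegral

/-- The function `|x| ^ (-1/2)`, with value `∞` at `0`. -/
noncomputable def invSqrtAbs (x : ℝ) : ENNReal := (ENNReal.ofReal √|x|)⁻¹

@[fun_prop]
lemma measurable_invSqrtAbs : Measurable invSqrtAbs := by
  unfold invSqrtAbs; fun_prop

/-- The geometric mean of the bounds `|c||x| ≤ K` and `|c||y| ≤ K`. If `x` or `y` is zero the
right-hand side is `∞`. -/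
lemma enorm_le_mul_invSqrtAbs {c x y K : ℝ} (hK : 0 < K) (hx : c ^ 2 * x ^ 2 ≤ K ^ 2)
    (hy : c ^ 2 * y ^ 2 ≤ K ^ 2) :
    ‖c‖ₑ ≤ ENNReal.ofReal K * (invSqrtAbs x * invSqrtAbs y) := by
  have hK' : ENNReal.ofReal K ≠ 0 := by simpa using hK
  have hne : ∀ z : ℝ, invSqrtAbs z ≠ 0 := fun z => by simp [invSqrtAbs]
  rcases eq_or_ne x 0 with rfl | hx0
  · have : invSqrtAbs 0 = ⊤ := by simp [invSqrtAbs]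
    rw [this, ENNReal.top_mul (hne y), ENNReal.mul_top hK']; exact le_top
  rcases eq_or_ne y 0 with rfl | hy0
  · have : invSqrtAbs 0 = ⊤ := by simp [invSqrtAbs]
    rw [this, ENNReal.mul_top (hne x), ENNReal.mul_top hK']; exact le_top
  have hx1 : 0 < √|x| := Real.sqrt_pos.2 (abs_pos.2 hx0)
  have hy1 : 0 < √|y| := Real.sqrt_pos.2 (abs_pos.2 hy0)
  rw [invSqrtAbs, invSqrtAbs, ← ENNReal.ofReal_inv_of_pos hx1, ← ENNReal.ofReal_inv_of_pos hy1,
    ← ENNReal.ofReal_mul (by positivity), ← ENNReal.ofReal_mul hK.le, Real.enorm_eq_ofReal_abs]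
  refine ENNReal.ofReal_le_ofReal ?_
  rw [← mul_inv, ← div_eq_mul_inv, le_div_iff₀ (by positivity)]
  have hx2 : |c| * |x| ≤ K :=
    (abs_le_of_sq_le_sq' (by rw [mul_pow, sq_abs, sq_abs]; exact hx) hK.le).2
  have hy2 : |c| * |y| ≤ K :=
    (abs_le_of_sq_le_sq' (by rw [mul_pow, sq_abs, sq_abs]; exact hy) hK.le).2
  refine abs_le_of_sq_le_sq' ?_ hK.le |>.2
  have e : (|c| * (√|x| * √|y|)) ^ 2 = (|c| * |x|) * (|c| * |y|) := by
    rw [mul_pow, mul_pow, Real.sq_sqrt (abs_nonneg x), Real.sq_sqrt (abs_nonneg y)]; ring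
  rw [e, sq]
  exact mul_le_mul hx2 hy2 (by positivity) hK.le

lemma setLIntegral_invSqrtAbs_lt_top :
    ∫⁻ x in Set.Ioc (-1) 1, invSqrtAbs x < ⊤ := by
  -- The complex power has norm `|x|^(-1/2)` on both sides of `0`.
  have h : IntervalIntegrable (fun x : ℝ => (x : ℂ) ^ (((-1 / 2 : ℝ)) : ℂ)) volume (-1) 1 :=
    intervalIntegral.intervalIntegrable_cpow' (by norm_num)
  have h1 := (intervalIntegrable_iff_integrableOn_Ioc_of_le (by norm_num)).1 h
  refine lt_of_le_of_lt (le_of_eq ?_) h1.2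
  refine lintegral_congr_ae ?_
  have h0 : ∀ᵐ x : ℝ ∂volume.restrict (Set.Ioc (-1) 1), x ≠ 0 :=
    ae_restrict_of_ae (Measure.ae_ne volume 0)
  filter_upwards [h0] with x hx
  have hx1 : 0 < √|x| := Real.sqrt_pos.2 (abs_pos.2 hx)
  rw [invSqrtAbs, ← ofReal_norm, Complex.norm_cpow_real, ← ENNReal.ofReal_inv_of_pos hx1,
    Complex.norm_real, Real.norm_eq_abs, Real.sqrt_eq_rpow, ← Real.rpow_neg (abs_nonneg x)]
  norm_num

/-- The expectation of `|X| ^ (-1/2)` is bounded over all Gaussian `X` of a given variance. -/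
lemma exists_lintegral_invSqrtAbs_le {v : ℝ≥0} (hv : v ≠ 0) :
    ∃ K : ENNReal, K ≠ ⊤ ∧ ∀ m, ∫⁻ x, invSqrtAbs x ∂gaussianReal m v ≤ K := by
  -- The peak of the density, which does not depend on the mean. Outside `(-1, 1]` the integrand is
  -- at most `1`.
  set p : ENNReal := ENNReal.ofReal (√(2 * Real.pi * v))⁻¹ with hp
  refine ⟨1 + p * ∫⁻ x in Set.Ioc (-1) 1, invSqrtAbs x, ?_, fun m => ?_⟩
  · exact ENNReal.add_ne_top.2 ⟨by simp,
      ENNReal.mul_ne_top ENNReal.ofReal_ne_top setLIntegral_invSqrtAbs_lt_top.ne⟩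
  have hle : ∀ x, invSqrtAbs x ≤ 1 + (Set.Ioc (-1 : ℝ) 1).indicator invSqrtAbs x := fun x => by
    by_cases hx : x ∈ Set.Ioc (-1 : ℝ) 1
    · rw [Set.indicator_of_mem hx]; exact le_add_self
    · refine le_add_right ?_
      rw [invSqrtAbs, ENNReal.inv_le_one, ENNReal.one_le_ofReal, Real.one_le_sqrt]
      by_contra! h
      rw [abs_lt] at h
      exact hx ⟨h.1, h.2.le⟩
  have hpdf : ∀ x, gaussianPDF m v x ≤ p := fun x => by
    refine ENNReal.ofReal_le_ofReal ?_
    rw [gaussianPDFReal]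
    refine mul_le_of_le_one_right (by positivity) (Real.exp_le_one_iff.2 ?_)
    rw [neg_div]
    exact neg_nonpos.2 (by positivity)
  calc ∫⁻ x, invSqrtAbs x ∂gaussianReal m v
      ≤ ∫⁻ x, (1 + (Set.Ioc (-1 : ℝ) 1).indicator invSqrtAbs x) ∂gaussianReal m v :=
        lintegral_mono hle
    _ = 1 + ∫⁻ x in Set.Ioc (-1 : ℝ) 1, invSqrtAbs x ∂gaussianReal m v := by
        rw [lintegral_add_left measurable_const, lintegral_indicator measurableSet_Ioc]; simp
    _ ≤ 1 + p * ∫⁻ x in Set.Ioc (-1) 1, invSqrtAbs x := by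
        gcongr
        rw [gaussianReal_of_var_ne_zero m hv,
          setLIntegral_withDensity_eq_setLIntegral_mul volume (measurable_gaussianPDF m v)
            measurable_invSqrtAbs measurableSet_Ioc,
          ← lintegral_const_mul p measurable_invSqrtAbs]
        refine lintegral_mono fun x => ?_
        exact mul_le_mul_left (hpdf x) _

end SingularIntegral

/-! ### Projections of a spherical Gaussian vector -/

section Projections

variable {τ : Type*} [Fintype τ]

lemma covariance_eval_pi_gaussianReal [DecidableEq τ] (v : ℝ≥0) (s t : τ) :
    cov[fun E => E s, fun E => E t; Measure.pi fun _ : τ => gaussianReal 0 v] =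
      if s = t then (v : ℝ) else 0 := by
  have hmem : ∀ s : τ, MemLp (fun E : τ → ℝ => E s) 2 (Measure.pi fun _ : τ => gaussianReal 0 v) :=
    fun s => (IsGaussian.memLp_two_id (μ := gaussianReal 0 v)).comp_measurePreserving
      (measurePreserving_eval (fun _ : τ => gaussianReal 0 v) s)
  split_ifs with h
  · subst h
    rw [covariance_self (measurable_pi_apply s).aemeasurable]
    have := (measurePreserving_eval (fun _ : τ => gaussianReal 0 v) s).variance_fun_comp
      (f := id) (by fun_prop)
    simpa using this
  · have hind := iIndepFun_pi (μ := fun _ : τ => gaussianReal 0 v) (X := fun _ x => x)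
      (fun _ => by fun_prop)
    exact (hind.indepFun h).covariance_eq_zero (hmem s) (hmem t)

lemma covariance_dotProduct_pi_gaussianReal (v : ℝ≥0) (e e' : τ → ℝ) :
    cov[fun E => E ⬝ᵥ e, fun E => E ⬝ᵥ e'; Measure.pi fun _ : τ => gaussianReal 0 v] =
      v * (e ⬝ᵥ e') := by
  have hmem : ∀ s : τ, MemLp (fun E : τ → ℝ => E s) 2 (Measure.pi fun _ : τ => gaussianReal 0 v) :=
    fun s => (IsGaussian.memLp_two_id (μ := gaussianReal 0 v)).comp_measurePreserving
      (measurePreserving_eval (fun _ : τ => gaussianReal 0 v) s)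
  simp only [dotProduct]
  rw [covariance_fun_sum_fun_sum (fun t => (hmem t).mul_const _) (fun t => (hmem t).mul_const _)]
  classical
  simp only [covariance_mul_const_left, covariance_mul_const_right,
    covariance_eval_pi_gaussianReal, ite_mul, zero_mul, Finset.sum_ite_eq,
    Finset.mem_univ, if_true, Finset.mul_sum, mul_assoc]

lemma hasGaussianLaw_dotProduct_pair (v : ℝ≥0) (e e' : τ → ℝ) :
    HasGaussianLaw (fun E : τ → ℝ => (E ⬝ᵥ e, E ⬝ᵥ e'))
      (Measure.pi fun _ : τ => gaussianReal 0 v) := by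
  have hid : HasGaussianLaw (fun E : τ → ℝ => fun t => E t)
      (Measure.pi fun _ : τ => gaussianReal 0 v) := by
    refine iIndepFun.hasGaussianLaw (fun t => ?_)
      (iIndepFun_pi (μ := fun _ : τ => gaussianReal 0 v) (X := fun _ x => x)
        (fun _ => by fun_prop))
    exact ((measurePreserving_eval (fun _ : τ => gaussianReal 0 v) t).hasLaw).hasGaussianLaw
  let L : (τ → ℝ) →L[ℝ] ℝ × ℝ := LinearMap.toContinuousLinearMap
    { toFun := fun E => (E ⬝ᵥ e, E ⬝ᵥ e')
      map_add' := fun x y => by simp [add_dotProduct]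
      map_smul' := fun c x => by simp [smul_dotProduct] }
  exact hid.map_fun L

/-- A proper subspace lies in the kernel of a nonzero functional, whose Gaussian law is
nondegenerate and so has no atoms. -/
lemma pi_gaussianReal_submodule {v : ℝ≥0} (hv : v ≠ 0) (x : τ → ℝ) (W : Submodule ℝ (τ → ℝ))
    (hW : W ≠ ⊤) : (Measure.pi fun _ : τ => gaussianReal 0 v) {y | x + y ∈ W} = 0 := by
  classical
  obtain ⟨f, hf0, hf⟩ := W.exists_le_ker_of_lt_top hW.lt_top
  set e : τ → ℝ := fun t => f (Pi.single t 1) with he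
  have hfe : ∀ y, f y = y ⬝ᵥ e := fun y => by
    conv_lhs => rw [pi_eq_sum_univ' y]
    simp [dotProduct, he, map_sum]
  have hee : e ⬝ᵥ e ≠ 0 := fun h => hf0 <| LinearMap.ext fun y => by
    rw [hfe, dotProduct_self_eq_zero.1 h]; simp
  have hlaw := ((hasGaussianLaw_dotProduct_pair v e e).fst).map_eq_gaussianReal
  have hmeas : Measurable fun E : τ → ℝ => E ⬝ᵥ e := by unfold dotProduct; fun_prop
  rw [← covariance_self hmeas.aemeasurable, covariance_dotProduct_pi_gaussianReal] at hlaw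
  set s : ℝ≥0 := (v * (e ⬝ᵥ e)).toNNReal
  have hs : s ≠ 0 := by
    have h1 : 0 ≤ e ⬝ᵥ e := Finset.sum_nonneg fun i _ => mul_self_nonneg _
    have h2 : (0 : ℝ) < v := by exact_mod_cast pos_iff_ne_zero.2 hv
    have h3 : 0 < v * (e ⬝ᵥ e) := mul_pos h2 (lt_of_le_of_ne h1 hee.symm)
    exact (Real.toNNReal_pos.2 h3).ne'
  have hatom := nullSingletonClass_gaussianReal
    (μ := ∫ E, E ⬝ᵥ e ∂(Measure.pi fun _ : τ => gaussianReal 0 v)) hs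
  refine measure_mono_null (t := (fun E => E ⬝ᵥ e) ⁻¹' {-(x ⬝ᵥ e)}) (fun y hy => ?_) ?_
  · have h4 : f (x + y) = 0 := hf hy
    rw [hfe, add_dotProduct] at h4
    simp only [Set.mem_preimage, Set.mem_singleton_iff]
    linarith
  · rw [← Measure.map_apply hmeas (measurableSet_singleton _), hlaw]
    exact measure_singleton _

/-- The components of a spherical Gaussian vector along two orthonormal vectors are independent, so
that the product of their `|·| ^ (-1/2)` is integrable, uniformly in the mean. -/
lemma exists_lintegral_invSqrtAbs_mul_le {v : ℝ≥0} (hv : v ≠ 0) :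
    ∃ K : ENNReal, K ≠ ⊤ ∧ ∀ (m e e' : τ → ℝ), e ⬝ᵥ e = 1 → e' ⬝ᵥ e' = 1 → e ⬝ᵥ e' = 0 →
      ∫⁻ E, invSqrtAbs ((m + E) ⬝ᵥ e) * invSqrtAbs ((m + E) ⬝ᵥ e')
        ∂(Measure.pi fun _ : τ => gaussianReal 0 v) ≤ K := by
  obtain ⟨K, hK, hle⟩ := exists_lintegral_invSqrtAbs_le hv
  refine ⟨K * K, ENNReal.mul_ne_top hK hK, fun m e e' he he' hee' => ?_⟩
  set μ := Measure.pi fun _ : τ => gaussianReal 0 v with hμ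
  have hmeas : ∀ e : τ → ℝ, Measurable fun E : τ → ℝ => E ⬝ᵥ e := fun e => by
    unfold dotProduct; fun_prop
  have hlaw : ∀ e : τ → ℝ, e ⬝ᵥ e = 1 →
      ∫⁻ E, invSqrtAbs ((m + E) ⬝ᵥ e) ∂μ ≤ K := fun e he => by
    have h1 := ((hasGaussianLaw_dotProduct_pair v e e).fst).map_eq_gaussianReal
    rw [← covariance_self (by fun_prop), covariance_dotProduct_pi_gaussianReal, he, mul_one,
      Real.toNNReal_coe] at h1
    calc ∫⁻ E, invSqrtAbs ((m + E) ⬝ᵥ e) ∂μ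
        = ∫⁻ x, invSqrtAbs (m ⬝ᵥ e + x) ∂(μ.map fun E => E ⬝ᵥ e) := by
          rw [lintegral_map (by fun_prop) (hmeas e)]; simp only [add_dotProduct]
      _ = ∫⁻ x, invSqrtAbs x ∂((μ.map fun E => E ⬝ᵥ e).map fun x => m ⬝ᵥ e + x) := by
          rw [lintegral_map (g := fun x => m ⬝ᵥ e + x) (by fun_prop) (by fun_prop)]
      _ ≤ K := by
          rw [h1, gaussianReal_map_const_add]
          exact hle _
  have hind : IndepFun (fun E : τ → ℝ => E ⬝ᵥ e) (fun E => E ⬝ᵥ e') μ := by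
    refine (hasGaussianLaw_dotProduct_pair v e e').indepFun_of_covariance_eq_zero ?_
    rw [covariance_dotProduct_pi_gaussianReal, hee', mul_zero]
  have hind' := hind.comp (φ := fun x => invSqrtAbs (m ⬝ᵥ e + x))
    (ψ := fun x => invSqrtAbs (m ⬝ᵥ e' + x)) (by fun_prop) (by fun_prop)
  have h2 := lintegral_mul_eq_lintegral_mul_lintegral_of_indepFun
    ((by fun_prop : Measurable fun x => invSqrtAbs (m ⬝ᵥ e + x)).comp (hmeas e))
    ((by fun_prop : Measurable fun x => invSqrtAbs (m ⬝ᵥ e' + x)).comp (hmeas e')) hind'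
  simp only [Pi.mul_apply, Function.comp_apply] at h2
  have h3 := hlaw e he
  have h4 := hlaw e' he'
  simp only [add_dotProduct] at h3 h4 ⊢
  rw [h2]
  exact mul_le_mul' h3 h4

/-- The orthogonal complement of the span of `n` vectors has dimension at least two. -/
lemma exists_orthonormal_pair_orthogonal {n : ℕ} (hn : n + 2 ≤ Fintype.card τ) (R : Fin n → τ → ℝ) :
    ∃ e e' : τ → ℝ, e ⬝ᵥ e = 1 ∧ e' ⬝ᵥ e' = 1 ∧ e ⬝ᵥ e' = 0 ∧
      ∀ i, R i ⬝ᵥ e = 0 ∧ R i ⬝ᵥ e' = 0 := by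
  set W : Submodule ℝ (EuclideanSpace ℝ τ) :=
    Submodule.span ℝ (Set.range fun i => WithLp.toLp 2 (R i)) with hW
  have h1 : Module.finrank ℝ W ≤ n := by
    simpa [Set.finrank] using
      finrank_range_le_card (R := ℝ) fun i => (WithLp.toLp 2 (R i) : EuclideanSpace ℝ τ)
  have h2 := W.finrank_add_finrank_orthogonal
  rw [finrank_euclideanSpace] at h2
  have hdot : ∀ x y : EuclideanSpace ℝ τ, (x : τ → ℝ) ⬝ᵥ (y : τ → ℝ) = inner ℝ x y := fun x y => by
    simp [EuclideanSpace.inner_eq_star_dotProduct, dotProduct_comm]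
  set B := stdOrthonormalBasis ℝ Wᗮ
  have hB := B.orthonormal
  let i0 : Fin (Module.finrank ℝ Wᗮ) := ⟨0, by omega⟩
  let i1 : Fin (Module.finrank ℝ Wᗮ) := ⟨1, by omega⟩
  have hone : ∀ i, inner ℝ (B i : EuclideanSpace ℝ τ) (B i : EuclideanSpace ℝ τ) = 1 := fun i => by
    rw [← Submodule.coe_inner, real_inner_self_eq_norm_sq, hB.1 i, one_pow]
  have hperp : ∀ k i, inner ℝ (WithLp.toLp 2 (R i) : EuclideanSpace ℝ τ)
      (B k : EuclideanSpace ℝ τ) = 0 := fun k i =>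
    (Submodule.mem_orthogonal W _).1 (B k).2 _ (Submodule.subset_span ⟨i, rfl⟩)
  refine ⟨(B i0 : EuclideanSpace ℝ τ), (B i1 : EuclideanSpace ℝ τ), ?_, ?_, ?_, fun i => ⟨?_, ?_⟩⟩
  · rw [hdot, hone]
  · rw [hdot, hone]
  · rw [hdot, ← Submodule.coe_inner]
    exact hB.2 (by simp [i0, i1])
  · simpa [hdot] using! (hdot _ _).trans (hperp i0 i)
  · simpa [hdot] using! (hdot _ _).trans (hperp i1 i)

end Projections

/-! ### Moments of least squares coefficients -/

section Moments

variable {τ : Type*} [Fintype τ]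

lemma measurable_leastSquares {m : Type*} [Fintype m] [DecidableEq m] :
    Measurable fun p : (m → τ → ℝ) × (τ → ℝ) => leastSquares (Matrix.of p.1) p.2 := by
  have h1 : Continuous fun p : (m → τ → ℝ) × (τ → ℝ) =>
      (Matrix.of p.1 * (Matrix.of p.1)ᵀ).det := by
    have : Continuous fun p : (m → τ → ℝ) × (τ → ℝ) => (Matrix.of p.1 : Matrix m τ ℝ) :=
      continuous_fst
    fun_prop
  have h2 : Continuous fun p : (m → τ → ℝ) × (τ → ℝ) =>
      (Matrix.of p.1 * (Matrix.of p.1)ᵀ).adjugate *ᵥ (Matrix.of p.1 *ᵥ p.2) := by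
    have : Continuous fun p : (m → τ → ℝ) × (τ → ℝ) => (Matrix.of p.1 : Matrix m τ ℝ) :=
      continuous_fst
    fun_prop
  have h3 : (fun p : (m → τ → ℝ) × (τ → ℝ) => leastSquares (Matrix.of p.1) p.2) = fun p =>
      ((Matrix.of p.1 * (Matrix.of p.1)ᵀ).det)⁻¹ •
        ((Matrix.of p.1 * (Matrix.of p.1)ᵀ).adjugate *ᵥ (Matrix.of p.1 *ᵥ p.2)) := by
    funext p
    rw [leastSquares, Matrix.inv_def, Ring.inverse_eq_inv', Matrix.smul_mulVec]
  rw [h3]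
  exact h1.measurable.inv.smul h2.measurable

/-- The law of a matrix with independent centred Gaussian entries, with variance `v i` in the
`i`-th row. -/
noncomputable def gaussianRows {n : ℕ} (τ : Type*) [Fintype τ] (v : Fin n → ℝ≥0) :
    Measure (Fin n → τ → ℝ) :=
  Measure.pi fun i => Measure.pi fun _ : τ => gaussianReal 0 (v i)

instance {n : ℕ} (v : Fin n → ℝ≥0) : IsProbabilityMeasure (gaussianRows τ v) := by
  unfold gaussianRows; infer_instance

lemma ae_isUnit_det_gaussianRows {n : ℕ} (hn : n ≤ Fintype.card τ) {v : Fin n → ℝ≥0}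
    (hv : ∀ i, v i ≠ 0) (N : Fin n → τ → ℝ) :
    ∀ᵐ E ∂gaussianRows τ v, IsUnit (Matrix.of (N + E) * (Matrix.of (N + E))ᵀ).det := by
  filter_upwards [ae_linearIndependent_add (V := τ → ℝ) (by simpa using hn) _
    (fun i => pi_gaussianReal_submodule (hv i)) N] with E hE
  exact isUnit_det_of_linearIndependent hE

/-- With fewer regressors than observations, least squares coefficients in a regression on
a perturbed Gaussian matrix have a finite first absolute moment. -/
lemma exists_lintegral_leastSquares_le {n : ℕ} (hn : n < Fintype.card τ) {v : Fin n → ℝ≥0}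
    (hv : ∀ i, v i ≠ 0) (j : Fin n) :
    ∃ K : ENNReal, K ≠ ⊤ ∧ ∀ (N : Fin n → τ → ℝ) (w : τ → ℝ),
      ∫⁻ E, ‖leastSquares (Matrix.of (N + E)) w j‖ₑ ∂gaussianRows τ v ≤
        K * ENNReal.ofReal (1 + ∑ t, |w t|) := by
  obtain ⟨K, hK, hle⟩ := exists_lintegral_invSqrtAbs_mul_le (τ := τ) (hv j)
  refine ⟨K, hK, fun N w => ?_⟩
  cases n with
  | zero => exact j.elim0
  | succ n =>
    have hc : 0 < 1 + ∑ t, |w t| := by positivity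
    have hw : w ⬝ᵥ w ≤ (1 + ∑ t, |w t|) ^ 2 := by
      have h1 : w ⬝ᵥ w ≤ (∑ t, |w t|) ^ 2 := by
        have := Finset.sum_sq_le_sq_sum_of_nonneg (s := Finset.univ) (f := fun t => |w t|)
          (fun t _ => abs_nonneg _)
        simpa [dotProduct, ← sq] using this
      refine h1.trans (pow_le_pow_left₀ (by positivity) (by linarith) 2)
    have hmeas : Measurable fun E : Fin (n + 1) → τ → ℝ =>
        ‖leastSquares (Matrix.of (N + E)) w j‖ₑ :=
      ((measurable_pi_apply j).comp (measurable_leastSquares.comp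
        ((measurable_const.add measurable_id).prodMk measurable_const))).enorm
    set e := MeasurableEquiv.piFinSuccAbove (fun _ : Fin (n + 1) => τ → ℝ) j with he
    have hmp := (measurePreserving_piFinSuccAbove
      (fun i : Fin (n + 1) => Measure.pi fun _ : τ => gaussianReal 0 (v i)) j).symm
    rw [gaussianRows, ← hmp.lintegral_comp hmeas]
    refine (lintegral_prod_symm _ (hmeas.comp hmp.measurable).aemeasurable).trans_le ?_
    refine (lintegral_mono (g := fun _ => K * ENNReal.ofReal (1 + ∑ t, |w t|)) fun R => ?_).trans
      (by simp)
    -- Here `n` counts the rows other than `j`, so `n + 1 < card τ` gives exactly the two spare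
    -- dimensions. The directions depend only on those rows, hence stay fixed while row `j` is
    -- integrated.
    obtain ⟨x, x', hx, hx', hxx', horth⟩ := exists_orthonormal_pair_orthogonal (τ := τ)
      (n := n) (by omega) (fun i => N (j.succAbove i) + R i)
    have hpt : ∀ y : τ → ℝ, ‖leastSquares (Matrix.of (N + e.symm (y, R))) w j‖ₑ ≤
        ENNReal.ofReal (1 + ∑ t, |w t|) *
          (invSqrtAbs ((N j + y) ⬝ᵥ x) * invSqrtAbs ((N j + y) ⬝ᵥ x')) := fun y => by
      have hrow : (Matrix.of (N + e.symm (y, R))) j = N j + y := by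
        change N j + (Fin.insertNth j y R : Fin (n + 1) → τ → ℝ) j = _
        rw [Fin.insertNth_apply_same]
      have hrow' : ∀ i, i ≠ j → ∃ k, (Matrix.of (N + e.symm (y, R))) i =
          N (j.succAbove k) + R k := fun i hi => by
        obtain ⟨k, rfl⟩ := Fin.exists_succAbove_eq hi
        refine ⟨k, ?_⟩
        change _ + (Fin.insertNth j y R : Fin (n + 1) → τ → ℝ) (j.succAbove k) = _
        rw [Fin.insertNth_apply_succAbove]
      rw [← hrow]
      refine enorm_le_mul_invSqrtAbs hc ((sq_leastSquares_mul_sq_le _ w x j hx ?_).trans hw)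
        ((sq_leastSquares_mul_sq_le _ w x' j hx' ?_).trans hw)
      · intro i hi
        obtain ⟨k, hk⟩ := hrow' i hi
        rw [hk]; exact (horth k).1
      · intro i hi
        obtain ⟨k, hk⟩ := hrow' i hi
        rw [hk]; exact (horth k).2
    refine (lintegral_mono hpt).trans ?_
    rw [lintegral_const_mul _ (by unfold dotProduct; fun_prop), mul_comm]
    exact mul_le_mul' (hle (N j) x x' hx hx' hxx') le_rfl

end Moments

/-! ### The Gaussian factor model -/

section Rows

variable {Ω : Type*} [MeasurableSpace Ω] {P : Measure Ω} {τ : Type*} [Fintype τ]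

/-- Links the row-by-row product used for Fubini to the family indexed by (unit, time) pairs, in
which the model states independence. -/
lemma gaussianRows_eq_map_curry {n : ℕ} (v : Fin n → ℝ≥0) :
    gaussianRows τ v =
      (Measure.pi fun q : Fin n × τ => gaussianReal 0 (v q.1)).map Function.curry := by
  have h1 : iIndepFun (fun (q : Fin n × τ) (E : Fin n → τ → ℝ) => E q.1 q.2)
      (gaussianRows τ v) := by
    refine iIndepFun_uncurry' (X := fun j t (E : Fin n → τ → ℝ) => E j t)
      (fun j t => by fun_prop) ?_ fun j => ?_
    · exact iIndepFun_pi (μ := fun i => Measure.pi fun _ : τ => gaussianReal 0 (v i))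
        (X := fun _ x => x) fun _ => by fun_prop
    · have h := iIndepFun_pi (μ := fun _ : τ => gaussianReal 0 (v j)) (X := fun _ x => x)
        fun _ => by fun_prop
      rw [← (measurePreserving_eval
        (fun i => Measure.pi fun _ : τ => gaussianReal 0 (v i)) j).map_eq] at h
      have hprob : IsProbabilityMeasure (Measure.map (Function.eval j)
          (Measure.pi fun i => Measure.pi fun _ : τ => gaussianReal 0 (v i))) :=
        Measure.isProbabilityMeasure_map (measurable_pi_apply j).aemeasurable
      rw [iIndepFun_iff_map_fun_eq_pi_map
        (fun t => (by fun_prop : Measurable fun x : τ → ℝ => x t).aemeasurable)] at h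
      rw [iIndepFun_iff_map_fun_eq_pi_map
        (fun t => (by fun_prop : Measurable fun E : Fin n → τ → ℝ => E j t).aemeasurable)]
      rw [Measure.map_map (by fun_prop) (by fun_prop)] at h
      have h' : ∀ t : τ, Measure.map (fun x : τ → ℝ => x t) (Measure.map (Function.eval j)
          (Measure.pi fun i => Measure.pi fun _ : τ => gaussianReal 0 (v i))) =
          Measure.map (fun E : Fin n → τ → ℝ => E j t) (gaussianRows τ v) := fun t => by
        rw [Measure.map_map (by fun_prop) (by fun_prop)]; rfl
      simp only [h'] at h
      exact h
  have h2 : ∀ q : Fin n × τ, HasLaw (fun E : Fin n → τ → ℝ => E q.1 q.2)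
      (gaussianReal 0 (v q.1)) (gaussianRows τ v) := fun q =>
    ((measurePreserving_eval (fun _ : τ => gaussianReal 0 (v q.1)) q.2).comp
      (measurePreserving_eval
        (fun i => Measure.pi fun _ : τ => gaussianReal 0 (v i)) q.1)).hasLaw
  rw [← (h1.hasLaw_pi h2).map_eq, Measure.map_map measurable_curry (by fun_prop)]
  exact Measure.map_id.symm

lemma hasLaw_gaussianRows {n : ℕ} {v : Fin n → ℝ≥0} {X : Fin n → τ → Ω → ℝ}
    (hlaw : ∀ j t, HasLaw (X j t) (gaussianReal 0 (v j)) P)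
    (hind : iIndepFun (fun (q : Fin n × τ) => X q.1 q.2) P) :
    HasLaw (fun ω j t => X j t ω) (gaussianRows τ v) P where
  aemeasurable := aemeasurable_pi_lambda _ fun j => aemeasurable_pi_lambda _ fun t =>
    (hlaw j t).aemeasurable
  map_eq := by
    have h := hind.hasLaw_pi (μ := fun q => gaussianReal 0 (v q.1)) fun q => hlaw q.1 q.2
    rw [gaussianRows_eq_map_curry, ← h.map_eq,
      AEMeasurable.map_map_of_aemeasurable measurable_curry.aemeasurable h.aemeasurable]
    rfl

end Rows

/-! ### Moments, independence and full rank in the factor model -/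

section Model

set_option linter.unusedSectionVars false

variable {Ω : Type*} [MeasurableSpace Ω] {P : Measure Ω} [IsProbabilityMeasure P] {F : ℕ}
  {mu : ℕ → Fin F → ℝ} {lam : ℤ → Ω → EuclideanSpace ℝ (Fin F)} {eps : ℕ → ℤ → Ω → ℝ}
  {σ : ℕ → ℝ≥0} {S : Matrix (Fin F) (Fin F) ℝ}

/-- The contribution of the factors to the outcome of unit `i` at time `t`. -/
def commonPart (lam : ℤ → Ω → EuclideanSpace ℝ (Fin F)) (mu : ℕ → Fin F → ℝ) (i : ℕ) (t : ℤ)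
    (ω : Ω) : ℝ :=
  ∑ f, lam t ω f * mu i f

lemma outcomeN_eq_add (i : ℕ) (t : ℤ) :
    outcomeN lam mu eps i t = commonPart lam mu i t + eps i t := rfl

namespace GaussianModel

lemma memLp_factor (h : GaussianModel P eps lam σ S) (t : ℤ) (f : Fin F) :
    MemLp (fun ω => lam t ω f) 2 P :=
  ((h.lam_law t).hasGaussianLaw.map_fun (EuclideanSpace.proj f)).memLp_two

lemma memLp_shock (h : GaussianModel P eps lam σ S) (i : ℕ) (t : ℤ) : MemLp (eps i t) 2 P :=
  (h.eps_law i t).hasGaussianLaw.memLp_two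

lemma memLp_commonPart (h : GaussianModel P eps lam σ S) (i : ℕ) (t : ℤ) :
    MemLp (commonPart lam mu i t) 2 P :=
  memLp_finsetSum _ fun f _ => (h.memLp_factor t f).mul_const _

lemma memLp_outcomeN (h : GaussianModel P eps lam σ S) (i : ℕ) (t : ℤ) :
    MemLp (outcomeN lam mu eps i t) 2 P :=
  (h.memLp_commonPart i t).add (h.memLp_shock i t)

lemma integral_outcomeN (h : GaussianModel P eps lam σ S) (i : ℕ) (t : ℤ) :
    ∫ ω, outcomeN lam mu eps i t ω ∂P = 0 := by
  have h1 : ∀ f, ∫ ω, lam t ω f ∂P = 0 := fun f => by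
    have h2 := (EuclideanSpace.proj (𝕜 := ℝ) f).integral_comp_comm
      (h.lam_law t).hasGaussianLaw.integrable
    rw [(h.lam_law t).integral_eq, integral_id_multivariateGaussian] at h2
    simpa using h2
  have h3 : ∫ ω, eps i t ω ∂P = 0 := by
    rw [(h.eps_law i t).integral_eq]; simp
  have hint : ∀ f, Integrable (fun ω => lam t ω f * mu i f) P := fun f =>
    ((h.memLp_factor t f).integrable (by norm_num)).mul_const _
  simp only [outcomeN]
  rw [integral_add (integrable_finsetSum _ fun f _ => hint f)
    ((h.memLp_shock i t).integrable (by norm_num)), integral_finsetSum _ fun f _ => hint f, h3]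
  simp [integral_mul_const, h1]

lemma covariance_factor (h : GaussianModel P eps lam σ S) (hS : S.PosSemidef) (t s : ℤ)
    (f g : Fin F) :
    cov[fun ω => lam t ω f, fun ω => lam s ω g; P] = if t = s then S f g else 0 := by
  split_ifs with hts
  · subst hts
    rw [(h.lam_law t).covariance_fun_comp (f := fun x => x f) (g := fun x => x g)
      (by fun_prop) (by fun_prop), covariance_eval_multivariateGaussian hS]
  · exact ((h.lam_indep.indepFun hts).comp (φ := fun x : EuclideanSpace ℝ (Fin F) => x f)
      (ψ := fun x : EuclideanSpace ℝ (Fin F) => x g) (by fun_prop)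
      (by fun_prop)).covariance_eq_zero (h.memLp_factor t f) (h.memLp_factor s g)

lemma covariance_shock (h : GaussianModel P eps lam σ S) (i k : ℕ) (t s : ℤ) :
    cov[eps i t, eps k s; P] = if t = s then (if i = k then (σ i : ℝ) ^ 2 else 0) else 0 := by
  by_cases hq : (i, t) = (k, s)
  · obtain ⟨rfl, rfl⟩ := Prod.mk.inj hq
    rw [covariance_self (h.eps_law i t).aemeasurable, (h.eps_law i t).variance_eq,
      variance_id_gaussianReal]
    simp
  · have h1 : cov[eps i t, eps k s; P] = 0 :=
      (h.eps_indep.indepFun hq).covariance_eq_zero (h.memLp_shock i t) (h.memLp_shock k s)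
    rw [h1]
    split_ifs with h2 h3
    · exact absurd (by rw [h2, h3]) hq
    · rfl
    · rfl

lemma covariance_commonPart (h : GaussianModel P eps lam σ S) (hS : S.PosSemidef) (i k : ℕ)
    (t s : ℤ) :
    cov[commonPart lam mu i t, commonPart lam mu k s; P] =
      if t = s then mu i ⬝ᵥ (S *ᵥ mu k) else 0 := by
  unfold commonPart
  rw [covariance_fun_sum_fun_sum (fun f => (h.memLp_factor t f).mul_const _)
    (fun g => (h.memLp_factor s g).mul_const _)]
  simp only [covariance_mul_const_left, covariance_mul_const_right, h.covariance_factor hS]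
  split_ifs with hts
  · simp only [dotProduct, Matrix.mulVec, Finset.mul_sum]
    refine Finset.sum_congr rfl fun f _ => Finset.sum_congr rfl fun g _ => ?_
    ring
  · simp

lemma covariance_commonPart_shock (h : GaussianModel P eps lam σ S) (i k : ℕ) (t s : ℤ) :
    cov[commonPart lam mu i t, eps k s; P] = 0 :=
  (h.eps_lam_indep.symm.comp (φ := fun l : ℤ → EuclideanSpace ℝ (Fin F) => ∑ f, l t f * mu i f)
    (ψ := fun e : ℕ × ℤ → ℝ => e (k, s)) (by fun_prop) (by fun_prop)).covariance_eq_zero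
    (h.memLp_commonPart i t) (h.memLp_shock k s)

lemma covariance_outcomeN (h : GaussianModel P eps lam σ S) (hS : S.PosSemidef) (i k : ℕ)
    (t s : ℤ) :
    cov[outcomeN lam mu eps i t, outcomeN lam mu eps k s; P] =
      if t = s then mu i ⬝ᵥ (S *ᵥ mu k) + (if i = k then (σ i : ℝ) ^ 2 else 0) else 0 := by
  simp only [outcomeN_eq_add]
  rw [covariance_add_left (h.memLp_commonPart i t) (h.memLp_shock i t)
    ((h.memLp_commonPart k s).add (h.memLp_shock k s)),
    covariance_add_right (h.memLp_commonPart i t) (h.memLp_commonPart k s) (h.memLp_shock k s),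
    covariance_add_right (h.memLp_shock i t) (h.memLp_commonPart k s) (h.memLp_shock k s),
    h.covariance_commonPart_shock, covariance_comm (eps i t), h.covariance_commonPart_shock,
    h.covariance_commonPart hS, h.covariance_shock]
  split_ifs <;> simp

/-- Finitely many outcomes are jointly Gaussian. -/
lemma hasGaussianLaw_outcomeN (h : GaussianModel P eps lam σ S) (n : ℕ) (I : Finset ℤ) :
    HasGaussianLaw (fun ω (q : Fin n × I) => outcomeN lam mu eps q.1 q.2 ω) P := by
  have h1 : HasGaussianLaw (fun ω (t : I) => lam t ω) P :=
    (h.lam_indep.precomp Subtype.val_injective).hasGaussianLaw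
      fun t : I => (h.lam_law t).hasGaussianLaw
  have hinj : Function.Injective fun q : Fin n × I => ((q.1 : ℕ), (q.2 : ℤ)) := by
    rintro ⟨a, b⟩ ⟨c, d⟩ hq
    obtain ⟨h1, h2⟩ := Prod.mk.inj hq
    exact Prod.ext (Fin.ext h1) (Subtype.ext h2)
  have h2 : HasGaussianLaw (fun ω (q : Fin n × I) => eps q.1 q.2 ω) P :=
    (h.eps_indep.precomp hinj).hasGaussianLaw
      fun q : Fin n × I => (h.eps_law q.1 q.2).hasGaussianLaw
  have h3 : IndepFun (fun ω (t : I) => lam t ω) (fun ω (q : Fin n × I) => eps q.1 q.2 ω) P :=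
    h.eps_lam_indep.symm.comp
      (φ := fun (l : ℤ → EuclideanSpace ℝ (Fin F)) (t : I) => l t)
      (ψ := fun (e : ℕ × ℤ → ℝ) (q : Fin n × I) => e (q.1, q.2)) (by fun_prop) (by fun_prop)
  let L : (I → EuclideanSpace ℝ (Fin F)) × (Fin n × I → ℝ) →L[ℝ] (Fin n × I → ℝ) :=
    LinearMap.toContinuousLinearMap
    { toFun := fun p q => (∑ f, p.1 q.2 f * mu q.1 f) + p.2 q
      map_add' := fun x y => by
        funext q
        simp only [Prod.fst_add, Prod.snd_add, Pi.add_apply, PiLp.add_apply, add_mul,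
          Finset.sum_add_distrib]
        ring
      map_smul' := fun c x => by
        funext q
        simp only [Prod.smul_fst, Prod.smul_snd, Pi.smul_apply, PiLp.smul_apply, smul_eq_mul,
          RingHom.id_apply, mul_add, Finset.mul_sum, mul_assoc] }
  exact (h3.hasGaussianLaw h1 h2).map_fun L

end GaussianModel

/-- The matrix of the outcomes of the first `n` controls at the times in `I`; its rows are
the units. -/
def controlRows (lam : ℤ → Ω → EuclideanSpace ℝ (Fin F)) (mu : ℕ → Fin F → ℝ)
    (eps : ℕ → ℤ → Ω → ℝ) (n : ℕ) (I : Finset ℤ) (ω : Ω) : Fin n → I → ℝ :=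
  fun j t => outcomeN lam mu eps ((j : ℕ) + 1) t ω

/-- The residuals of the regression of the treated unit on the controls with coefficients `g`. -/
def regressionResidual (lam : ℤ → Ω → EuclideanSpace ℝ (Fin F)) (mu : ℕ → Fin F → ℝ)
    (eps : ℕ → ℤ → Ω → ℝ) {n : ℕ} (g : Fin n → ℝ) (I : Finset ℤ) (ω : Ω) : I → ℝ :=
  fun t => outcomeN lam mu eps 0 t ω - ∑ j, g j * outcomeN lam mu eps ((j : ℕ) + 1) t ω

/-- The population regression coefficients of the treated unit on the first `n` controls. -/
noncomputable def modelWeights (mu : ℕ → Fin F → ℝ) (σ : ℕ → ℝ≥0) (S : Matrix (Fin F) (Fin F) ℝ)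
    (n : ℕ) : Fin n → ℝ :=
  populationWeights (loadingMatrix mu n) S (fun j => (σ ((j : ℕ) + 1) : ℝ) ^ 2) (mu 0)

namespace GaussianModel

lemma memLp_regressionResidual (h : GaussianModel P eps lam σ S) {n : ℕ} (g : Fin n → ℝ)
    (I : Finset ℤ) (t : I) : MemLp (fun ω => regressionResidual lam mu eps g I ω t) 2 P :=
  (h.memLp_outcomeN 0 t).sub
    (memLp_finsetSum _ fun j _ => (h.memLp_outcomeN ((j : ℕ) + 1) t).const_mul (g j))

lemma integral_regressionResidual (h : GaussianModel P eps lam σ S) {n : ℕ} (g : Fin n → ℝ)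
    (I : Finset ℤ) (t : I) : ∫ ω, regressionResidual lam mu eps g I ω t ∂P = 0 := by
  have hint : ∀ i, Integrable (fun ω => outcomeN lam mu eps i t ω) P := fun i =>
    (h.memLp_outcomeN i t).integrable (by norm_num)
  simp only [regressionResidual]
  rw [integral_sub (hint 0) (integrable_finsetSum _ fun j _ => (hint _).const_mul _),
    integral_finsetSum _ fun j _ => (hint _).const_mul _]
  simp [integral_const_mul, h.integral_outcomeN]

/-- At equal times this is the population normal equation; at distinct times every covariance
vanishes. -/
lemma covariance_regressionResidual (h : GaussianModel P eps lam σ S) (hS : S.PosDef)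
    (hσ : ∀ j, 1 ≤ j → 0 < σ j) {n : ℕ} (I : Finset ℤ) (t s : I) (k : Fin n) :
    cov[fun ω => regressionResidual lam mu eps (modelWeights mu σ S n) I ω t,
      fun ω => controlRows lam mu eps n I ω k s; P] = 0 := by
  have hsymm : ∀ x y : Fin F → ℝ, x ⬝ᵥ (S *ᵥ y) = y ⬝ᵥ (S *ᵥ x) := fun x y => by
    have hST : Sᵀ = S := by
      have := hS.isHermitian.eq
      rwa [Matrix.conjTranspose_eq_transpose_of_trivial] at this
    rw [Matrix.dotProduct_mulVec, ← Matrix.mulVec_transpose, hST, dotProduct_comm]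
  have hmem := fun i => h.memLp_outcomeN (mu := mu) i t
  simp only [regressionResidual, controlRows]
  rw [covariance_fun_sub_left (hmem 0) (memLp_finsetSum _ fun j _ => (hmem _).const_mul _)
    (h.memLp_outcomeN _ _),
    covariance_fun_sum_left (fun j => (hmem _).const_mul _) (h.memLp_outcomeN _ _)]
  simp only [covariance_const_mul_left, h.covariance_outcomeN hS.posSemidef]
  by_cases hts : (t : ℤ) = s
  · have hpop := congrFun (mulVec_populationWeights (M := loadingMatrix mu n) (μ₀ := mu 0)
      (d := fun j : Fin n => (σ ((j : ℕ) + 1) : ℝ) ^ 2) hS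
      (fun j => pow_pos (by exact_mod_cast hσ _ (by omega)) 2)) k
    rw [Matrix.add_mulVec, Pi.add_apply, Matrix.mulVec_diagonal] at hpop
    have e1 : (loadingMatrix mu n *ᵥ (S *ᵥ mu 0)) k = mu ((k : ℕ) + 1) ⬝ᵥ (S *ᵥ mu 0) := rfl
    have e2 : ((loadingMatrix mu n * S * (loadingMatrix mu n)ᵀ) *ᵥ modelWeights mu σ S n) k =
        ∑ j : Fin n, mu ((k : ℕ) + 1) ⬝ᵥ (S *ᵥ mu ((j : ℕ) + 1)) * modelWeights mu σ S n j := by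
      rw [Matrix.mul_assoc]; rfl
    change ((loadingMatrix mu n * S * (loadingMatrix mu n)ᵀ) *ᵥ modelWeights mu σ S n) k +
      (σ ((k : ℕ) + 1) : ℝ) ^ 2 * modelWeights mu σ S n k = _ at hpop
    rw [e1, e2] at hpop
    simp only [hts, if_true, mul_add, mul_ite, mul_zero, add_left_inj, Finset.sum_add_distrib,
      Fin.val_inj, Finset.sum_ite_eq', Finset.mem_univ]
    -- Control `k` is unit `k + 1 ≠ 0`, so the treated unit's own shock does not enter.
    rw [if_neg (by omega), add_zero, hsymm, ← hpop]
    have e3 : ∀ j : Fin n, modelWeights mu σ S n j *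
        (mu ((j : ℕ) + 1) ⬝ᵥ (S *ᵥ mu ((k : ℕ) + 1))) =
        mu ((k : ℕ) + 1) ⬝ᵥ (S *ᵥ mu ((j : ℕ) + 1)) * modelWeights mu σ S n j := fun j => by
      rw [hsymm, mul_comm]
    simp only [e3]
    ring
  · simp [hts]

/-- Uncorrelated jointly Gaussian families are independent, and both families are linear images of
one Gaussian vector of outcomes. -/
lemma indepFun_controlRows_regressionResidual (h : GaussianModel P eps lam σ S) (hS : S.PosDef)
    (hσ : ∀ j, 1 ≤ j → 0 < σ j) (n : ℕ) (I : Finset ℤ) :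
    IndepFun (controlRows lam mu eps n I)
      (regressionResidual lam mu eps (modelWeights mu σ S n) I) P := by
  have hg := h.hasGaussianLaw_outcomeN (mu := mu) (n + 1) I
  let L : (Fin (n + 1) × I → ℝ) →L[ℝ] (Fin n × I → ℝ) × (I → ℝ) :=
    LinearMap.toContinuousLinearMap
    { toFun := fun y => (fun q => y (q.1.succ, q.2),
        fun t => y (0, t) - ∑ j, modelWeights mu σ S n j * y (j.succ, t))
      map_add' := fun x y => by
        ext
        · rfl
        · simp only [Pi.add_apply, Prod.snd_add, mul_add, Finset.sum_add_distrib]; ring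
      map_smul' := fun c x => by
        ext
        · rfl
        · simp only [Pi.smul_apply, Prod.smul_snd, smul_eq_mul, RingHom.id_apply, mul_sub,
            Finset.mul_sum, mul_left_comm c] }
  have h1 := (hg.map_fun L).indepFun_of_covariance_eval
    (X := fun q : Fin n × I => fun ω => controlRows lam mu eps n I ω q.1 q.2)
    (Y := fun t ω => regressionResidual lam mu eps (modelWeights mu σ S n) I ω t)
    (fun q t => by rw [covariance_comm]; exact h.covariance_regressionResidual hS hσ I t q.2 q.1)
  exact h1.comp measurable_curry measurable_id

lemma hasLaw_shocks (h : GaussianModel P eps lam σ S) (n : ℕ) (I : Finset ℤ) :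
    HasLaw (fun ω (j : Fin n) (t : I) => eps ((j : ℕ) + 1) t ω)
      (gaussianRows I fun j : Fin n => σ ((j : ℕ) + 1) ^ 2) P := by
  have hinj : Function.Injective fun q : Fin n × I => ((q.1 : ℕ) + 1, (q.2 : ℤ)) := by
    rintro ⟨a, b⟩ ⟨c, d⟩ hq
    obtain ⟨h1, h2⟩ := Prod.mk.inj hq
    exact Prod.ext (Fin.ext (by simpa using h1)) (Subtype.ext h2)
  exact hasLaw_gaussianRows (fun j t => h.eps_law _ _) (h.eps_indep.precomp hinj)

lemma indepFun_common_shocks (h : GaussianModel P eps lam σ S) (n : ℕ) (I : Finset ℤ) :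
    IndepFun (fun ω (j : Fin n) (t : I) => commonPart lam mu ((j : ℕ) + 1) t ω)
      (fun ω (j : Fin n) (t : I) => eps ((j : ℕ) + 1) t ω) P :=
  h.eps_lam_indep.symm.comp
    (φ := fun (l : ℤ → EuclideanSpace ℝ (Fin F)) (j : Fin n) (t : I) =>
      ∑ f, l t f * mu ((j : ℕ) + 1) f)
    (ψ := fun (e : ℕ × ℤ → ℝ) (j : Fin n) (t : I) => e ((j : ℕ) + 1, t))
    (by fun_prop) (by fun_prop)

lemma aemeasurable_common (h : GaussianModel P eps lam σ S) (n : ℕ) (I : Finset ℤ) :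
    AEMeasurable (fun ω (j : Fin n) (t : I) => commonPart lam mu ((j : ℕ) + 1) t ω) P :=
  aemeasurable_pi_lambda _ fun _ => aemeasurable_pi_lambda _ fun _ =>
    (h.memLp_commonPart _ _).aestronglyMeasurable.aemeasurable

lemma aemeasurable_controlRows (h : GaussianModel P eps lam σ S) (n : ℕ) (I : Finset ℤ) :
    AEMeasurable (controlRows lam mu eps n I) P :=
  aemeasurable_pi_lambda _ fun _ => aemeasurable_pi_lambda _ fun _ =>
    (h.memLp_outcomeN _ _).aestronglyMeasurable.aemeasurable

lemma aemeasurable_regressionResidual (h : GaussianModel P eps lam σ S) {n : ℕ} (g : Fin n → ℝ)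
    (I : Finset ℤ) : AEMeasurable (regressionResidual lam mu eps g I) P :=
  aemeasurable_pi_lambda _ fun t =>
    (h.memLp_regressionResidual g I t).aestronglyMeasurable.aemeasurable

/-- Expectations over the control outcomes can be computed by integrating over the shocks first. -/
lemma lintegral_controlRows (h : GaussianModel P eps lam σ S) (n : ℕ) (I : Finset ℤ)
    {φ : (Fin n → I → ℝ) → ENNReal} (hφ : Measurable φ) :
    ∫⁻ ω, φ (controlRows lam mu eps n I ω) ∂P =
      ∫⁻ N, ∫⁻ E, φ (N + E) ∂(gaussianRows I fun j : Fin n => σ ((j : ℕ) + 1) ^ 2)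
        ∂(P.map fun ω (j : Fin n) (t : I) => commonPart lam mu ((j : ℕ) + 1) t ω) := by
  have hE := h.hasLaw_shocks n I
  have hN := h.aemeasurable_common (mu := mu) n I
  have hmap := (h.indepFun_common_shocks (mu := mu) n I).map_prod_eq_prod_map_map hN
    hE.aemeasurable
  rw [hE.map_eq] at hmap
  rw [← lintegral_prod (fun p => φ (p.1 + p.2)) (by fun_prop), ← hmap,
    lintegral_map' (by fun_prop) (hN.prodMk hE.aemeasurable)]
  rfl

/-- Given the common parts, the independent nondegenerate shocks alone make the rows linearly
independent almost surely. -/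
lemma ae_isUnit_det_controlRows (h : GaussianModel P eps lam σ S) (hσ : ∀ j, 1 ≤ j → 0 < σ j)
    {n : ℕ} {I : Finset ℤ} (hn : n ≤ I.card) :
    ∀ᵐ ω ∂P, IsUnit (Matrix.of (controlRows lam mu eps n I ω) *
      (Matrix.of (controlRows lam mu eps n I ω))ᵀ).det := by
  set A : Set (Fin n → I → ℝ) :=
    {C | ¬ IsUnit (Matrix.of C * (Matrix.of C)ᵀ).det} with hA
  have hAmeas : MeasurableSet A := by
    have hc : Continuous fun C : Fin n → I → ℝ => (Matrix.of C * (Matrix.of C)ᵀ).det := by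
      have : Continuous fun C : Fin n → I → ℝ => (Matrix.of C : Matrix (Fin n) I ℝ) :=
        continuous_id
      fun_prop
    have : A = (fun C : Fin n → I → ℝ => (Matrix.of C * (Matrix.of C)ᵀ).det) ⁻¹' {0} := by
      ext C; simp [hA]
    rw [this]
    exact hc.measurable (measurableSet_singleton 0)
  have h1 := h.lintegral_controlRows (mu := mu) n I (φ := A.indicator 1)
    (measurable_one.indicator hAmeas)
  have h2 : ∀ N : Fin n → I → ℝ, ∫⁻ E, A.indicator 1 (N + E)
      ∂(gaussianRows I fun j : Fin n => σ ((j : ℕ) + 1) ^ 2) = 0 := fun N => by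
    refine (lintegral_eq_zero_iff
      ((measurable_one.indicator hAmeas).comp (measurable_const_add N))).2 ?_
    filter_upwards [ae_isUnit_det_gaussianRows (by simpa using hn)
      (fun j => pow_ne_zero 2 (hσ ((j : ℕ) + 1) (by omega)).ne') N] with E hE
    have hnot : N + E ∉ A := fun hmem => hmem hE
    simp [hnot]
  simp only [h2, lintegral_zero] at h1
  have h3 := (lintegral_eq_zero_iff' ((measurable_one.indicator hAmeas).comp_aemeasurable
    (h.aemeasurable_controlRows n I))).1 h1
  filter_upwards [h3] with ω hω
  by_contra hc
  have : controlRows lam mu eps n I ω ∈ A := hc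
  simp [this] at hω

/-- With fewer controls than periods, the least squares coefficients in the regression of
the residuals on the controls are integrable. -/
lemma integrable_leastSquares (h : GaussianModel P eps lam σ S) (hS : S.PosDef)
    (hσ : ∀ j, 1 ≤ j → 0 < σ j) {n : ℕ} {I : Finset ℤ} (hn : n < I.card) (j : Fin n) :
    Integrable (fun ω => leastSquares (Matrix.of (controlRows lam mu eps n I ω))
      (regressionResidual lam mu eps (modelWeights mu σ S n) I ω) j) P := by
  set C := controlRows lam mu eps n I
  set u := regressionResidual lam mu eps (modelWeights mu σ S n) I
  have hC : AEMeasurable C P := h.aemeasurable_controlRows n I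
  have hu : AEMeasurable u P := h.aemeasurable_regressionResidual _ I
  have hmeas : Measurable fun p : (Fin n → I → ℝ) × (I → ℝ) =>
      leastSquares (Matrix.of p.1) p.2 j :=
    (measurable_pi_apply j).comp measurable_leastSquares
  refine ⟨(hmeas.comp_aemeasurable (hC.prodMk hu)).aestronglyMeasurable, ?_⟩
  obtain ⟨K, hK, hle⟩ := exists_lintegral_leastSquares_le (τ := I) (by simpa using hn)
    (v := fun j : Fin n => σ ((j : ℕ) + 1) ^ 2)
    (fun j => pow_ne_zero 2 (hσ ((j : ℕ) + 1) (by omega)).ne') j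
  have hmap := (h.indepFun_controlRows_regressionResidual (mu := mu) hS hσ n I)
    |>.map_prod_eq_prod_map_map hC hu
  -- By independence the residuals can be frozen at `w`; the bound grows linearly in `w`, so a first
  -- moment of the residuals suffices.
  have hfix : ∀ w : I → ℝ, ∫⁻ c, ‖leastSquares (Matrix.of c) w j‖ₑ ∂(P.map C) ≤
      K * ENNReal.ofReal (1 + ∑ t, |w t|) := fun w => by
    have hw : Measurable fun c : Fin n → I → ℝ => ‖leastSquares (Matrix.of c) w j‖ₑ :=
      (hmeas.comp (measurable_id.prodMk measurable_const)).enorm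
    have hprob : IsProbabilityMeasure
        (P.map fun ω (j : Fin n) (t : I) => commonPart lam mu ((j : ℕ) + 1) t ω) :=
      Measure.isProbabilityMeasure_map (h.aemeasurable_common n I)
    rw [lintegral_map' hw.aemeasurable hC, h.lintegral_controlRows n I hw]
    exact (lintegral_mono fun N => hle N w).trans (by simp)
  have hint : Integrable (fun ω => 1 + ∑ t, |u ω t|) P :=
    (integrable_const 1).add (integrable_finsetSum _ fun t _ =>
      ((h.memLp_regressionResidual _ I t).integrable (by norm_num)).abs)
  calc ∫⁻ ω, ‖leastSquares (Matrix.of (C ω)) (u ω) j‖ₑ ∂P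
      = ∫⁻ p, ‖leastSquares (Matrix.of p.1) p.2 j‖ₑ ∂((P.map C).prod (P.map u)) := by
        rw [← hmap, lintegral_map' hmeas.enorm.aemeasurable (hC.prodMk hu)]
    _ = ∫⁻ w, ∫⁻ c, ‖leastSquares (Matrix.of c) w j‖ₑ ∂(P.map C) ∂(P.map u) :=
        lintegral_prod_symm _ hmeas.enorm.aemeasurable
    _ ≤ ∫⁻ w, K * ENNReal.ofReal (1 + ∑ t, |w t|) ∂(P.map u) := lintegral_mono hfix
    _ = K * ∫⁻ ω, ENNReal.ofReal (1 + ∑ t, |u ω t|) ∂P := by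
        have hm : Measurable fun w : I → ℝ => ENNReal.ofReal (1 + ∑ t, |w t|) := by fun_prop
        rw [lintegral_const_mul _ hm, lintegral_map' hm.aemeasurable hu]
    _ < ⊤ := ENNReal.mul_lt_top hK.lt_top hint.lintegral_lt_top

end GaussianModel

end Model

/-! ### Conditional means of functions of independent variables -/

section CondMean

variable {Ω 𝓧 𝓤 : Type*} [MeasurableSpace Ω] [MeasurableSpace 𝓧] [MeasurableSpace 𝓤]
  {P : Measure Ω} [IsProbabilityMeasure P] {F : ℕ} {Z : Ω → Fin F → ℝ} {X : Ω → 𝓧} {U : Ω → 𝓤}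
  {G : 𝓧 × 𝓤 → Fin F → ℝ} {v : Fin F → ℝ}

/-- The law of `G (x, U)` disintegrates the joint law of `(X, Z)`, so it is the conditional
distribution. Only the sections `G (x, ·)` need be integrable, which covers `J = T₀`. -/
lemma hasConstCondMean_of_indepFun (hX : AEMeasurable X P) (hU : AEMeasurable U P)
    (hXU : IndepFun X U P) (hG : Measurable G) (hZ : Z =ᵐ[P] fun ω => G (X ω, U ω))
    (hint : ∀ x, Integrable (fun u => G (x, u)) (P.map U))
    (hmean : ∀ x, ∫ u, G (x, u) ∂(P.map U) = v) : HasConstCondMean P Z X v := by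
  have hprobU : IsProbabilityMeasure (P.map U) := Measure.isProbabilityMeasure_map hU
  set κ : Kernel 𝓧 (Fin F → ℝ) := (Kernel.id ×ₖ Kernel.const 𝓧 (P.map U)).map G with hκ
  have hGx : ∀ x, Measurable fun u => G (x, u) := fun x => hG.comp measurable_prodMk_left
  have hκx : ∀ x, κ x = (P.map U).map fun u => G (x, u) := fun x => by
    rw [hκ, Kernel.map_apply _ hG, Kernel.prod_apply, Kernel.id_apply, Kernel.const_apply,
      Measure.dirac_prod, Measure.map_map hG measurable_prodMk_left]
    rfl
  have hGXU : AEMeasurable (fun ω => G (X ω, U ω)) P := hG.comp_aemeasurable (hX.prodMk hU)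
  have hZm : AEMeasurable Z P := hGXU.congr hZ.symm
  have hmap : P.map (fun ω => (X ω, Z ω)) = P.map X ⊗ₘ κ := by
    have h1 : P.map (fun ω => (X ω, Z ω)) =
        ((P.map X).prod (P.map U)).map fun p => (p.1, G p) := by
      rw [← hXU.map_prod_eq_prod_map_map hX hU,
        AEMeasurable.map_map_of_aemeasurable (by fun_prop) (hX.prodMk hU)]
      refine Measure.map_congr ?_
      filter_upwards [hZ] with ω hω
      simp [hω]
    rw [h1]
    ext s hs
    rw [Measure.map_apply (by fun_prop) hs, Measure.prod_apply (by measurability),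
      Measure.compProd_apply hs]
    refine lintegral_congr fun x => ?_
    rw [hκx, Measure.map_apply (hGx x) (measurable_prodMk_left hs)]
    rfl
  have hcd := condDistrib_ae_eq_of_measure_eq_compProd X hZm hmap
  filter_upwards [ae_of_ae_map hX hcd] with ω hω
  rw [hω, hκx]
  refine ⟨?_, ?_⟩
  · rw [integrable_map_measure (by fun_prop) (hGx _).aemeasurable]
    exact hint (X ω)
  · rw [integral_map (hGx _).aemeasurable (by fun_prop)]
    exact hmean (X ω)

lemma integral_eq_of_indepFun (hX : AEMeasurable X P) (hU : AEMeasurable U P)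
    (hXU : IndepFun X U P) (hG : Measurable G) (hZ : Z =ᵐ[P] fun ω => G (X ω, U ω))
    (hmean : ∀ x, ∫ u, G (x, u) ∂(P.map U) = v) (hZint : Integrable Z P) :
    ∫ ω, Z ω ∂P = v := by
  have hprobU : IsProbabilityMeasure (P.map U) := Measure.isProbabilityMeasure_map hU
  have hprobX : IsProbabilityMeasure (P.map X) := Measure.isProbabilityMeasure_map hX
  have hmap := hXU.map_prod_eq_prod_map_map hX hU
  have hGint : Integrable G ((P.map X).prod (P.map U)) := by
    rw [← hmap, integrable_map_measure hG.aestronglyMeasurable (hX.prodMk hU)]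
    exact hZint.congr hZ
  rw [integral_congr_ae hZ, ← integral_map (hX.prodMk hU) hG.aestronglyMeasurable (f := G), hmap,
    integral_prod _ hGint]
  simp [hmean]

end CondMean

/-! ### The implied loadings -/

section Main

variable {Ω : Type*} [MeasurableSpace Ω] {P : Measure Ω} [IsProbabilityMeasure P] {F : ℕ}
  {mu : ℕ → Fin F → ℝ} {lam : ℤ → Ω → EuclideanSpace ℝ (Fin F)} {eps alpha : ℕ → ℤ → Ω → ℝ}
  {σ : ℕ → ℝ≥0} {S : Matrix (Fin F) (Fin F) ℝ}

set_option linter.unusedSectionVars false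

/-- The bias of the implied loadings with `n` controls. -/
noncomputable def modelBias (mu : ℕ → Fin F → ℝ) (σ : ℕ → ℝ≥0) (S : Matrix (Fin F) (Fin F) ℝ)
    (n : ℕ) : Fin F → ℝ :=
  populationBias (loadingMatrix mu n) S (fun j : Fin n => (σ ((j : ℕ) + 1) : ℝ) ^ 2) (mu 0)

/-- The error of the implied loadings, as a function of the control outcomes and
of the residuals of the population regression. -/
noncomputable def loadingError (mu : ℕ → Fin F → ℝ) (σ : ℕ → ℝ≥0) (S : Matrix (Fin F) (Fin F) ℝ)
    {n : ℕ} {I : Finset ℤ} (p : (I → Fin n → ℝ) × (I → ℝ)) : Fin F → ℝ :=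
  modelBias mu σ S n +
    (loadingMatrix mu n)ᵀ *ᵥ leastSquares (Matrix.of fun j t => p.1 t j) p.2

lemma measurable_loadingError {n : ℕ} {I : Finset ℤ} :
    Measurable (loadingError mu σ S : (I → Fin n → ℝ) × (I → ℝ) → Fin F → ℝ) := by
  have h1 : Measurable fun p : (I → Fin n → ℝ) × (I → ℝ) =>
      leastSquares (Matrix.of fun j t => p.1 t j) p.2 :=
    measurable_leastSquares.comp (f := fun p : (I → Fin n → ℝ) × (I → ℝ) =>
      ((fun j t => p.1 t j, p.2) : (Fin n → I → ℝ) × (I → ℝ))) (by fun_prop)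
  have h2 : Continuous fun b : Fin n → ℝ => modelBias mu σ S n + (loadingMatrix mu n)ᵀ *ᵥ b := by
    fun_prop
  exact h2.measurable.comp h1

lemma outcome_preTimes {T₀ : ℕ} (i : ℕ) (t : preTimes T₀) (ω : Ω) :
    outcome lam mu eps alpha i t ω = outcomeN lam mu eps i t ω := by
  have ht : ¬ (0 : ℤ) < t := not_lt.2 (Finset.mem_Icc.1 t.2).2
  simp [outcome, treated, ht]

lemma card_preTimes (T₀ : ℕ) : (preTimes T₀).card = T₀ := by
  simp [preTimes, Int.card_Icc]

lemma olsObjective_outcome (T₀ n : ℕ) (b : Fin n → ℝ) (ω : Ω) :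
    olsObjective (fun i t => outcome lam mu eps alpha i t ω) T₀ n b =
      (1 / (T₀ : ℝ)) *
        (((fun t : preTimes T₀ => outcomeN lam mu eps 0 t ω) -
          (Matrix.of (controlRows lam mu eps n (preTimes T₀) ω))ᵀ *ᵥ b) ⬝ᵥ
        ((fun t : preTimes T₀ => outcomeN lam mu eps 0 t ω) -
          (Matrix.of (controlRows lam mu eps n (preTimes T₀) ω))ᵀ *ᵥ b)) := by
  rw [olsObjective, ← Finset.sum_coe_sort, dotProduct]
  congr 1
  refine Finset.sum_congr rfl fun t _ => ?_
  simp only [outcome_preTimes, Pi.sub_apply, Matrix.mulVec, dotProduct, Matrix.transpose_apply,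
    Matrix.of_apply, controlRows, sq, mul_comm (b _)]

lemma IsOLS.eq_leastSquares {T₀ n : ℕ} {b : Fin n → ℝ} {ω : Ω}
    (hb : IsOLS (fun i t => outcome lam mu eps alpha i t ω) T₀ n b)
    (hC : IsUnit (Matrix.of (controlRows lam mu eps n (preTimes T₀) ω) *
      (Matrix.of (controlRows lam mu eps n (preTimes T₀) ω))ᵀ).det) :
    b = leastSquares (Matrix.of (controlRows lam mu eps n (preTimes T₀) ω))
      (fun t : preTimes T₀ => outcomeN lam mu eps 0 t ω) := by
  refine eq_leastSquares_of_minimizer hC fun b' => ?_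
  -- For `T₀ = 0` the factor `1 / T₀` is `0` and cannot be cancelled, but both losses are empty
  -- sums.
  rcases Nat.eq_zero_or_pos T₀ with rfl | hT
  · have : IsEmpty (preTimes 0) := by
      rw [← Fintype.card_eq_zero_iff, Fintype.card_coe, card_preTimes]
    simp [dotProduct]
  · have h := hb b'
    rw [olsObjective_outcome, olsObjective_outcome] at h
    exact le_of_mul_le_mul_left h (by positivity)

/-- Least squares is linear and reproduces `modelWeights` exactly from their fitted values, so only
the regression of the residuals remains random around the bias. -/
lemma impliedLoadings_sub_eq {T₀ n : ℕ} {b : Fin n → ℝ} {ω : Ω}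
    (hb : IsOLS (fun i t => outcome lam mu eps alpha i t ω) T₀ n b)
    (hC : IsUnit (Matrix.of (controlRows lam mu eps n (preTimes T₀) ω) *
      (Matrix.of (controlRows lam mu eps n (preTimes T₀) ω))ᵀ).det) :
    impliedLoadings mu b - mu 0 = loadingError mu σ S
      (controlOutcomes (outcome lam mu eps alpha) T₀ n ω,
        regressionResidual lam mu eps (modelWeights mu σ S n) (preTimes T₀) ω) := by
  set C := controlRows lam mu eps n (preTimes T₀) ω with hCdef
  have h1 : (fun t : preTimes T₀ => outcomeN lam mu eps 0 t ω) =
      (Matrix.of C)ᵀ *ᵥ modelWeights mu σ S n +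
        regressionResidual lam mu eps (modelWeights mu σ S n) (preTimes T₀) ω := by
    funext t
    simp only [Pi.add_apply, Matrix.mulVec, dotProduct, Matrix.transpose_apply, Matrix.of_apply,
      regressionResidual, hCdef, controlRows, mul_comm (modelWeights mu σ S n _)]
    ring
  have h2 : (fun (j : Fin n) (t : preTimes T₀) =>
      controlOutcomes (outcome lam mu eps alpha) T₀ n ω t j) = C := by
    funext j t
    exact outcome_preTimes _ _ _
  rw [hb.eq_leastSquares hC, h1, leastSquares_add, leastSquares_transpose_mulVec hC, loadingError,
    h2, impliedLoadings, Matrix.mulVec_add, modelBias, populationBias, modelWeights]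
  abel

lemma integrable_loadingError {n : ℕ} {I : Finset ℤ} {ν : Measure (I → ℝ)} [IsProbabilityMeasure ν]
    (hν : ∀ t, Integrable (fun u : I → ℝ => u t) ν) (x : I → Fin n → ℝ) :
    Integrable (fun u => loadingError mu σ S (x, u)) ν := by
  have hu : Integrable (fun u : I → ℝ => u) ν := Integrable.of_eval hν
  let L : (I → ℝ) →L[ℝ] (Fin F → ℝ) := LinearMap.toContinuousLinearMap
    { toFun := fun u => (loadingMatrix mu n)ᵀ *ᵥ leastSquares (Matrix.of fun j t => x t j) u
      map_add' := fun u w => by rw [leastSquares_add, Matrix.mulVec_add]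
      map_smul' := fun c u => by simp [leastSquares, Matrix.mulVec_smul] }
  exact (integrable_const _).add (L.integrable_comp hu)

/-- For fixed control outcomes the error is affine in the centred residuals. This holds for every
`x`, even rank deficient, since `leastSquares` is then zero. -/
lemma integral_loadingError {n : ℕ} {I : Finset ℤ} {ν : Measure (I → ℝ)} [IsProbabilityMeasure ν]
    (hν : ∀ t, Integrable (fun u : I → ℝ => u t) ν) (hν0 : ∀ t, ∫ u, u t ∂ν = 0)
    (x : I → Fin n → ℝ) :
    ∫ u, loadingError mu σ S (x, u) ∂ν = modelBias mu σ S n := by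
  have hu : Integrable (fun u : I → ℝ => u) ν := Integrable.of_eval hν
  have hu0 : ∫ u, u ∂ν = 0 := by
    funext t
    rw [eval_integral hν]
    exact hν0 t
  let L : (I → ℝ) →L[ℝ] (Fin F → ℝ) := LinearMap.toContinuousLinearMap
    { toFun := fun u => (loadingMatrix mu n)ᵀ *ᵥ leastSquares (Matrix.of fun j t => x t j) u
      map_add' := fun u w => by rw [leastSquares_add, Matrix.mulVec_add]
      map_smul' := fun c u => by simp [leastSquares, Matrix.mulVec_smul] }
  change ∫ u, (modelBias mu σ S n + L u) ∂ν = _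
  rw [integral_add (integrable_const _) (L.integrable_comp hu), L.integral_comp_comm hu, hu0]
  simp

namespace GaussianModel

lemma ae_impliedLoadings_sub_eq (h : GaussianModel P eps lam σ S) (hσ : ∀ j, 1 ≤ j → 0 < σ j)
    {T₀ n : ℕ} (hn : n ≤ T₀) {bhat : Ω → Fin n → ℝ}
    (hb : ∀ᵐ ω ∂P, IsOLS (fun i t => outcome lam mu eps alpha i t ω) T₀ n (bhat ω)) :
    (fun ω => impliedLoadings mu (bhat ω) - mu 0) =ᵐ[P] fun ω => loadingError mu σ S
      (controlOutcomes (outcome lam mu eps alpha) T₀ n ω,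
        regressionResidual lam mu eps (modelWeights mu σ S n) (preTimes T₀) ω) := by
  filter_upwards [hb, h.ae_isUnit_det_controlRows (mu := mu) hσ (n := n) (I := preTimes T₀)
    (by rwa [card_preTimes])] with ω h1 h2
  exact impliedLoadings_sub_eq h1 h2

lemma controlOutcomes_eq {T₀ n : ℕ} :
    controlOutcomes (outcome lam mu eps alpha) T₀ n =
      fun ω t j => controlRows lam mu eps n (preTimes T₀) ω j t := by
  funext ω t j
  exact outcome_preTimes _ _ _

lemma indepFun_controlOutcomes (h : GaussianModel P eps lam σ S) (hS : S.PosDef)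
    (hσ : ∀ j, 1 ≤ j → 0 < σ j) (T₀ n : ℕ) :
    IndepFun (controlOutcomes (outcome lam mu eps alpha) T₀ n)
      (regressionResidual lam mu eps (modelWeights mu σ S n) (preTimes T₀)) P := by
  rw [controlOutcomes_eq]
  exact (h.indepFun_controlRows_regressionResidual hS hσ n (preTimes T₀)).comp
    (φ := fun (C : Fin n → preTimes T₀ → ℝ) t j => C j t) (by fun_prop) measurable_id

lemma aemeasurable_controlOutcomes (h : GaussianModel P eps lam σ S) (T₀ n : ℕ) :
    AEMeasurable (controlOutcomes (outcome lam mu eps alpha) T₀ n) P := by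
  rw [controlOutcomes_eq]
  exact (by fun_prop : Measurable fun (C : Fin n → preTimes T₀ → ℝ) t j => C j t).comp_aemeasurable
    (h.aemeasurable_controlRows n (preTimes T₀))

lemma integrable_eval_map_regressionResidual (h : GaussianModel P eps lam σ S) {n : ℕ}
    (g : Fin n → ℝ) (I : Finset ℤ) (t : I) :
    Integrable (fun u : I → ℝ => u t) (P.map (regressionResidual lam mu eps g I)) := by
  rw [integrable_map_measure (measurable_pi_apply t).aestronglyMeasurable
    (h.aemeasurable_regressionResidual g I)]
  exact (h.memLp_regressionResidual g I t).integrable (by norm_num)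

lemma integral_eval_map_regressionResidual (h : GaussianModel P eps lam σ S) {n : ℕ}
    (g : Fin n → ℝ) (I : Finset ℤ) (t : I) :
    ∫ u, u t ∂(P.map (regressionResidual lam mu eps g I)) = 0 := by
  rw [integral_map (h.aemeasurable_regressionResidual g I)
    (measurable_pi_apply t).aestronglyMeasurable]
  exact h.integral_regressionResidual g I t

variable {T₀ n : ℕ} {bhat : Ω → Fin n → ℝ}

lemma integrable_impliedLoadings_sub (h : GaussianModel P eps lam σ S) (hS : S.PosDef)
    (hσ : ∀ j, 1 ≤ j → 0 < σ j) (hn : n < T₀)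
    (hb : ∀ᵐ ω ∂P, IsOLS (fun i t => outcome lam mu eps alpha i t ω) T₀ n (bhat ω)) :
    Integrable (fun ω => impliedLoadings mu (bhat ω) - mu 0) P := by
  refine Integrable.congr ?_ (h.ae_impliedLoadings_sub_eq hσ hn.le hb).symm
  have hls : Integrable (fun ω => leastSquares
      (Matrix.of (controlRows lam mu eps n (preTimes T₀) ω))
      (regressionResidual lam mu eps (modelWeights mu σ S n) (preTimes T₀) ω)) P :=
    Integrable.of_eval fun j => h.integrable_leastSquares hS hσ (by rwa [card_preTimes]) j
  let L : (Fin n → ℝ) →L[ℝ] (Fin F → ℝ) :=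
    LinearMap.toContinuousLinearMap (Matrix.mulVecLin (loadingMatrix mu n)ᵀ)
  have h1 := (integrable_const (modelBias mu σ S n)).add (L.integrable_comp hls)
  simpa only [controlOutcomes_eq] using! h1

lemma hasConstCondMean_impliedLoadings_sub (h : GaussianModel P eps lam σ S) (hS : S.PosDef)
    (hσ : ∀ j, 1 ≤ j → 0 < σ j) (hn : n ≤ T₀)
    (hb : ∀ᵐ ω ∂P, IsOLS (fun i t => outcome lam mu eps alpha i t ω) T₀ n (bhat ω)) :
    HasConstCondMean P (fun ω => impliedLoadings mu (bhat ω) - mu 0)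
      (controlOutcomes (outcome lam mu eps alpha) T₀ n) (modelBias mu σ S n) := by
  have hu := h.aemeasurable_regressionResidual (mu := mu) (modelWeights mu σ S n) (preTimes T₀)
  have hprob := Measure.isProbabilityMeasure_map hu
  exact hasConstCondMean_of_indepFun (h.aemeasurable_controlOutcomes T₀ n) hu
    (h.indepFun_controlOutcomes hS hσ T₀ n) measurable_loadingError
    (h.ae_impliedLoadings_sub_eq hσ hn hb)
    (integrable_loadingError (h.integrable_eval_map_regressionResidual _ _))
    (integral_loadingError (h.integrable_eval_map_regressionResidual _ _)
      (h.integral_eval_map_regressionResidual _ _))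

lemma integral_impliedLoadings_sub (h : GaussianModel P eps lam σ S) (hS : S.PosDef)
    (hσ : ∀ j, 1 ≤ j → 0 < σ j) (hn : n ≤ T₀)
    (hb : ∀ᵐ ω ∂P, IsOLS (fun i t => outcome lam mu eps alpha i t ω) T₀ n (bhat ω))
    (hint : Integrable (fun ω => impliedLoadings mu (bhat ω) - mu 0) P) :
    ∫ ω, (impliedLoadings mu (bhat ω) - mu 0) ∂P = modelBias mu σ S n := by
  have hu := h.aemeasurable_regressionResidual (mu := mu) (modelWeights mu σ S n) (preTimes T₀)
  have hprob := Measure.isProbabilityMeasure_map hu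
  exact integral_eq_of_indepFun (h.aemeasurable_controlOutcomes T₀ n) hu
    (h.indepFun_controlOutcomes hS hσ T₀ n) measurable_loadingError
    (h.ae_impliedLoadings_sub_eq hσ hn hb)
    (integral_loadingError (h.integrable_eval_map_regressionResidual _ _)
      (h.integral_eval_map_regressionResidual _ _)) hint

end GaussianModel

lemma tendsto_modelBias (hF : 1 ≤ F) {a b : ℝ} (ha : 0 < a)
    (hgroups : Tendsto (fun n : ℕ => numGroups mu a b n) atTop atTop) (hS : S.PosDef)
    (hσ : ∀ j, 1 ≤ j → 0 < σ j) (hbdd : ∃ C : ℝ≥0, ∀ i, σ i ≤ C) :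
    Tendsto (modelBias mu σ S) atTop (𝓝 0) := by
  obtain ⟨C, hC⟩ := hbdd
  exact tendsto_populationBias hF ha hgroups hS (v := fun j => (σ j : ℝ) ^ 2)
    (fun j hj => pow_pos (by exact_mod_cast hσ j hj) 2) (K := (C : ℝ) ^ 2)
    (fun j => pow_le_pow_left₀ (by positivity) (by exact_mod_cast hC j) 2)

end Main

end SynthControl

theorem proposition3 {Ω : Type*} [MeasurableSpace Ω] (P : Measure Ω) [IsProbabilityMeasure P]
    (F : ℕ) (hF : 1 ≤ F)
    (mu : ℕ → Fin F → ℝ)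
    (lam : ℤ → Ω → EuclideanSpace ℝ (Fin F))
    (eps : ℕ → ℤ → Ω → ℝ)
    (alpha : ℕ → ℤ → Ω → ℝ)
    (σ : ℕ → ℝ≥0) (S : Matrix (Fin F) (Fin F) ℝ)
    (hS : S.PosDef)
    (hσpos : ∀ j, 1 ≤ j → 0 < σ j)
    (hσbdd : ∃ C : ℝ≥0, ∀ i, σ i ≤ C)
    (hmodel : SynthControl.GaussianModel P eps lam σ S)
    (a b : ℝ) (ha : 0 < a) (hb : 0 < b)
    (hgroups : Tendsto (fun n : ℕ => SynthControl.numGroups mu a b n) atTop atTop)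
    (J : ℕ → ℕ) (hJ : Tendsto J atTop atTop) (hJT : ∀ T₀, J T₀ ≤ T₀)
    (bhat : ∀ T₀ : ℕ, Ω → Fin (J T₀) → ℝ)
    (hbhat : ∀ T₀, ∀ᵐ ω ∂P, SynthControl.IsOLS
      (fun i t => SynthControl.outcome lam mu eps alpha i t ω) T₀ (J T₀) (bhat T₀ ω)) :
    (∀ T₀, J T₀ < T₀ →
      Integrable (fun ω => SynthControl.impliedLoadings mu (bhat T₀ ω) - mu 0) P) ∧
    ∃ bias : ℕ → Fin F → ℝ,
      (∀ T₀, SynthControl.HasConstCondMean P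
        (fun ω => SynthControl.impliedLoadings mu (bhat T₀ ω) - mu 0)
        (SynthControl.controlOutcomes (SynthControl.outcome lam mu eps alpha) T₀ (J T₀))
        (bias T₀)) ∧
      (∀ T₀, Integrable (fun ω => SynthControl.impliedLoadings mu (bhat T₀ ω) - mu 0) P →
        ∫ ω, (SynthControl.impliedLoadings mu (bhat T₀ ω) - mu 0) ∂P = bias T₀) ∧
      Tendsto bias atTop (𝓝 0) := by
  exact ⟨fun T₀ hT => hmodel.integrable_impliedLoadings_sub hS hσpos hT (hbhat T₀),
    -- The bias is a fixed sequence in the number of controls, evaluated along `J`.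
    fun T₀ => SynthControl.modelBias mu σ S (J T₀),
    fun T₀ => hmodel.hasConstCondMean_impliedLoadings_sub hS hσpos (hJT T₀) (hbhat T₀),
    fun T₀ => hmodel.integral_impliedLoadings_sub hS hσpos (hJT T₀) (hbhat T₀),
    (SynthControl.tendsto_modelBias hF ha hgroups hS hσpos hσbdd).comp hJ⟩
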